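/- Let $R$ be a complete admissible ring, i.e. a one-dimensional Noetherian local ring, complete for the topology of its maximal ideal, Cohen--Macaulay, analytically reduced, residually rational (every residue field of the integral closure of $R$ in its total ring of fractions $K$ equals the residue field of $R$), and whose residue field has at least as many elements as $R$ has minimal primes. Assume that $R$ has exactly three minimal primes $\wp_1,\wp_2,\wp_3$. For $\emptyset\ne J\subseteq\{1,2,3\}$ put $R_J=R/\bigcap_{j\in J}\wp_j$, let $K_J$ be its total ring of fractions and $\pi_J\colon K\to K_J$ the projection; write $\pi_i,K_i$ for $J=\{i\}$. The integral closure of $R/\wp_i$ in $K_i$ is a discrete valuation ring; let $v_i\colon K_i\to\mathbb Z\cup\{\infty\}$ be its normalized valuation. Let $\mathcal I\subset K$ be a regular fractional ideal of $R$: an $R$-submodule that contains a regular element of $R$ and satisfies $d\,\mathcal I\subseteq R$ for some regular $d\in R$. Let $$E=\{(v_i(\pi_i(h)))_{i=1,2,3} : h\in\mathcal I \text{ not a zero divisor of } K\}\subset\mathbb Z^3$$ be its value set, and let $E_J\subset\mathbb Z^J$ be the set of the vectors $(v_j(g_j))_{j\in J}$, where $g\in\pi_J(\mathcal I)$ is not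 a zero divisor of $K_J$ and $g_j$ is its image in $K_j$; write $E_i=E_{\{i\}}\subset\mathbb Z$. For $\gamma\in\mathbb Z^3$ put $\mathcal I(\gamma)=\{h\in\mathcal I : v_i(\pi_i(h))\ge\gamma_i,\ i=1,2,3\}$, and let $\mathcal L(E_i)$ be the set of integers $n>\min E_i$ with $n\notin E_i$. For a finite index set $T$, $A\subset\mathbb Z^T$, $\alpha\in\mathbb Z^T$ and $\emptyset\neq J\subseteq T$ let $F_J(A,\alpha)$ be the set of $\beta\in A$ with $\beta_j=\alpha_j$ for $j\in J$ and $\beta_j>\alpha_j$ for $j\in T\setminus J$. A point $\alpha\in A$ is maximal if $F_{\{i\}}(A,\alpha)=\emptyset$ for all $i\in T$. A maximal point $\alpha$ is an absolute maximal if $F_J(A,\alpha)=\emptyset$ for all $\emptyset\ne J\subsetneq T$, and a relative maximal if $F_J(A,\alpha)\neq\emptyset$ for all $J\subseteq T$ with $\#J\ge2$. Let $M(A)$, $AM(A)$, $RM(A)$ be the sets of maximals, absolute maximals and relative maximals of $A$. Then, for the product order, $E$ has a least element $\alpha^0$ and a conductor $c(E)$, the least $\delta\in\mathbb Z^3$ with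 $\delta+\mathbb N^3\subseteq E$; the sets $\mathcal L(E_i)$, $M(E_{\{i,j\}})$ $(i<j)$, $RM(E)$, $AM(E)$ are finite; and for every $\gamma\ge c(E)$ the $R$-module $\mathcal I/\mathcal I(\gamma)$ has finite length, equal to $$\ell_R\!\left(\frac{\mathcal I}{\mathcal I(\gamma)}\right)=\sum_{i=1}^{3}\bigl((\gamma_i-\alpha^0_i)-\#\mathcal L(E_i)\bigr)-\sum_{1\le i<j\le 3}\#M(E_{\{i,j\}})-\#RM(E)+\#AM(E).$$ -/

import Mathlib

open scoped nonZeroDivisors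

noncomputable section

namespace AdmissibleRing

universe u

section DVR

variable (A K : Type*) [CommRing A] [IsDomain A] [IsDiscreteValuationRing A] [Field K]
  [Algebra A K] [IsFractionRing A K]

open Classical in
/-- The normalized valuation, with values in `ℤ ∪ {∞}`, of the field of fractions `K` of a
discrete valuation ring `A`. -/
def dvrVal (x : K) : WithTop ℤ :=
  if x = 0 then ⊤
  else ((-WithZero.log ((IsDiscreteValuationRing.maximalIdeal A).valuation K x) : ℤ) : WithTop ℤ)

theorem le_dvrVal_iff (n : ℤ) (x : K) : (n : WithTop ℤ) ≤ dvrVal A K x ↔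
    (IsDiscreteValuationRing.maximalIdeal A).valuation K x ≤ WithZero.exp (-n) := by
  by_cases hx : x = 0
  · simp [dvrVal, hx]
  · rw [dvrVal, if_neg hx, WithTop.coe_le_coe, ← WithZero.log_le_iff_le_exp
      ((Valuation.ne_zero_iff _).2 hx)]
    omega

theorem le_dvrVal_add (n : ℤ) (x y : K) (hx : (n : WithTop ℤ) ≤ dvrVal A K x)
    (hy : (n : WithTop ℤ) ≤ dvrVal A K y) : (n : WithTop ℤ) ≤ dvrVal A K (x + y) := by
  rw [le_dvrVal_iff] at *
  exact Valuation.map_add_le _ hx hy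

theorem le_dvrVal_mul (n : ℤ) (a : A) (x : K) (hx : (n : WithTop ℤ) ≤ dvrVal A K x) :
    (n : WithTop ℤ) ≤ dvrVal A K (algebraMap A K a * x) := by
  rw [le_dvrVal_iff] at *
  rw [map_mul]
  exact (mul_le_of_le_one_left'
    ((IsDiscreteValuationRing.maximalIdeal A).valuation_le_one a)).trans hx

end DVR

section Branches

variable {R : Type u} [CommRing R]

/-- The branch `R_P = R / P` at a minimal prime `P` of `R`. -/
abbrev Branch (P : minimalPrimes R) : Type u := R ⧸ P.1

instance branchIsDomain (P : minimalPrimes R) : IsDomain (Branch P) :=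
  have : P.1.IsPrime := P.2.1.1
  Ideal.Quotient.isDomain P.1

/-- The field of fractions `K_P` of the branch `R / P`. -/
abbrev BranchField (P : minimalPrimes R) : Type u := FractionRing (Branch P)

/-- The integral closure of the branch `R / P` in its field of fractions. -/
abbrev BranchNormalization (P : minimalPrimes R) : Subalgebra (Branch P) (BranchField P) :=
  integralClosure (Branch P) (BranchField P)

instance branchNormalizationIsFractionRing (P : minimalPrimes R) :
    IsFractionRing (BranchNormalization P) (BranchField P) :=
  integralClosure.isFractionRing_of_finite_extension (A := Branch P) (BranchField P)
    (BranchField P)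

open Classical in
/-- The normalized valuation of the field `K_P`, with values in `ℤ ∪ {∞}`, given by the discrete
valuation ring `BranchNormalization P`. (The last, conventional value is not used: for the
rings considered below, the normalization of a branch is a discrete valuation ring.) -/
def branchVal (P : minimalPrimes R) (x : BranchField P) : WithTop ℤ :=
  if _h : IsDiscreteValuationRing (BranchNormalization P) then
    dvrVal (BranchNormalization P) (BranchField P) x
  else if x = 0 then ⊤ else 0

theorem branchVal_zero (P : minimalPrimes R) : branchVal P 0 = ⊤ := by
  by_cases h : IsDiscreteValuationRing (BranchNormalization P) <;> simp [branchVal, dvrVal, h]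

theorem le_branchVal_add (P : minimalPrimes R) (n : ℤ) (x y : BranchField P)
    (hx : (n : WithTop ℤ) ≤ branchVal P x) (hy : (n : WithTop ℤ) ≤ branchVal P y) :
    (n : WithTop ℤ) ≤ branchVal P (x + y) := by
  by_cases h : IsDiscreteValuationRing (BranchNormalization P)
  · simp only [branchVal, h, dif_pos] at hx hy ⊢
    exact le_dvrVal_add _ _ n x y hx hy
  · by_cases hx0 : x = 0
    · simpa [hx0] using hy
    by_cases hxy : x + y = 0
    · simp [branchVal, hxy, h]
    simpa [branchVal, hx0, hxy, h] using hx

theorem le_branchVal_mul (P : minimalPrimes R) (n : ℤ) (a : Branch P) (x : BranchField P)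
    (hx : (n : WithTop ℤ) ≤ branchVal P x) :
    (n : WithTop ℤ) ≤ branchVal P (algebraMap (Branch P) (BranchField P) a * x) := by
  by_cases h : IsDiscreteValuationRing (BranchNormalization P)
  · simp only [branchVal, h, dif_pos] at hx ⊢
    exact le_dvrVal_mul _ _ n (algebraMap (Branch P) (BranchNormalization P) a) x hx
  · by_cases hax : algebraMap (Branch P) (BranchField P) a * x = 0
    · simp only [branchVal, hax, h]
      simp
    simp only [branchVal, hax, right_ne_zero_of_mul hax, h] at hx ⊢
    exact hx

/-- A regular element of `R` stays regular modulo a minimal prime. -/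
theorem nonZeroDivisors_le_comap_branch (P : minimalPrimes R) :
    R⁰ ≤ (Branch P)⁰.comap (Ideal.Quotient.mk P.1) := by
  intro x hx
  rw [Submonoid.mem_comap, mem_nonZeroDivisors_iff_ne_zero, Ne, Ideal.Quotient.eq_zero_iff_mem]
  exact fun h => Set.disjoint_left.mp (Ideal.disjoint_nonZeroDivisors_of_mem_minimalPrimes P.2) h hx

/-- The projection `π_P : K → K_P` from the total ring of fractions of `R`. -/
def projBranch (P : minimalPrimes R) : FractionRing R →+* BranchField P :=
  IsLocalization.map (BranchField P) (Ideal.Quotient.mk P.1) (nonZeroDivisors_le_comap_branch P)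

variable {ι : Type*} (p : ι → minimalPrimes R)

/-- The intersection of the minimal primes with index in `J`. -/
def interIdeal (J : Finset ι) : Ideal R := ⨅ j ∈ J, (p j).1

/-- The ring `R_J`, the quotient of `R` by the intersection of the minimal primes indexed by `J`. -/
abbrev PartialRing (J : Finset ι) : Type u := R ⧸ interIdeal p J

/-- The total ring of fractions `K_J` of `R_J`. -/
abbrev PartialFractions (J : Finset ι) : Type u := FractionRing (PartialRing p J)

theorem interIdeal_le (J : Finset ι) (j : J) : interIdeal p J ≤ (p j).1 :=
  iInf₂_le j.1 j.2

theorem nonZeroDivisors_le_comap_partial (J : Finset ι) :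
    R⁰ ≤ (PartialRing p J)⁰.comap (Ideal.Quotient.mk (interIdeal p J)) := by
  intro x hx
  rw [Submonoid.mem_comap, mem_nonZeroDivisors_iff_right]
  intro z hz
  obtain ⟨y, rfl⟩ := Ideal.Quotient.mk_surjective z
  rw [← map_mul, Ideal.Quotient.eq_zero_iff_mem] at hz
  rw [Ideal.Quotient.eq_zero_iff_mem]
  simp only [interIdeal, Ideal.mem_iInf] at hz ⊢
  intro j hj
  have : (p j).1.IsPrime := (p j).2.1.1
  exact (this.mem_or_mem (hz j hj)).resolve_right fun h =>
    Set.disjoint_left.mp (Ideal.disjoint_nonZeroDivisors_of_mem_minimalPrimes (p j).2) h hx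

/-- The projection `π_J : K → K_J`. -/
def projPartial (J : Finset ι) : FractionRing R →+* PartialFractions p J :=
  IsLocalization.map (PartialFractions p J) (Ideal.Quotient.mk (interIdeal p J))
    (nonZeroDivisors_le_comap_partial p J)

theorem nonZeroDivisors_le_comap_factor (J : Finset ι) (j : J) :
    (PartialRing p J)⁰ ≤ (Branch (p j))⁰.comap (Ideal.Quotient.factor (interIdeal_le p J j)) := by
  intro x hx
  obtain ⟨a, rfl⟩ := Ideal.Quotient.mk_surjective x
  have hprime : (p j).1.IsPrime := (p j).2.1.1
  rw [Submonoid.mem_comap, mem_nonZeroDivisors_iff_ne_zero, Ne, Ideal.Quotient.factor_mk,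
    Ideal.Quotient.eq_zero_iff_mem]
  intro ha
  let q : Ideal (PartialRing p J) := (p j).1.map (Ideal.Quotient.mk (interIdeal p J))
  have hcomap : q.comap (Ideal.Quotient.mk (interIdeal p J)) = (p j).1 := by
    rw [Ideal.comap_map_of_surjective _ Ideal.Quotient.mk_surjective, ← RingHom.ker_eq_comap_bot,
      Ideal.mk_ker, sup_eq_left]
    exact interIdeal_le p J j
  have hq : q ∈ minimalPrimes (PartialRing p J) := by
    refine ⟨⟨?_, bot_le⟩, ?_⟩
    · exact Ideal.map_isPrime_of_surjective Ideal.Quotient.mk_surjective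
        (by rw [Ideal.mk_ker]; exact interIdeal_le p J j)
    · rintro q' ⟨hq', -⟩ hle
      have h1 : q'.comap (Ideal.Quotient.mk (interIdeal p J)) ≤ (p j).1 :=
        hcomap ▸ Ideal.comap_mono hle
      have h2 : (p j).1 ≤ q'.comap (Ideal.Quotient.mk (interIdeal p J)) :=
        (p j).2.2 ⟨Ideal.IsPrime.comap _, bot_le⟩ h1
      exact Ideal.map_le_iff_le_comap.2 h2
  exact Set.disjoint_left.mp (Ideal.disjoint_nonZeroDivisors_of_mem_minimalPrimes hq)
    (Ideal.mem_map_of_mem _ ha) hx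

/-- The projection `K_J → K_j`, for `j ∈ J`. -/
def projPartialBranch (J : Finset ι) (j : J) : PartialFractions p J →+* BranchField (p j) :=
  IsLocalization.map (BranchField (p j)) (Ideal.Quotient.factor (interIdeal_le p J j))
    (nonZeroDivisors_le_comap_factor p J j)

/-- The value set `E = v(𝓘 \ Z(K)) ⊆ ℤ^ι`. -/
def valueSet (𝓘 : FractionalIdeal R⁰ (FractionRing R)) : Set (ι → ℤ) :=
  {α | ∃ h ∈ 𝓘, h ∈ (FractionRing R)⁰ ∧
    ∀ i, branchVal (p i) (projBranch (p i) h) = (α i : WithTop ℤ)}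

/-- The value set `E_J = v(π_J(𝓘) \ Z(K_J)) ⊆ ℤ^J`. -/
def partialValueSet (𝓘 : FractionalIdeal R⁰ (FractionRing R)) (J : Finset ι) : Set (J → ℤ) :=
  {β | ∃ g ∈ projPartial p J '' (𝓘 : Set (FractionRing R)), g ∈ (PartialFractions p J)⁰ ∧
    ∀ j : J, branchVal (p j) (projPartialBranch p J j g) = (β j : WithTop ℤ)}

/-- The value set `E_i = E_{i}`, regarded as a set of integers. -/
def singleValueSet (𝓘 : FractionalIdeal R⁰ (FractionRing R)) (i : ι) : Set ℤ :=
  {n | (fun _ => n) ∈ partialValueSet p 𝓘 {i}}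

/-- The submodule `𝓘(α) = {h ∈ 𝓘 ; v(h) ≥ α}` of `𝓘`, where `v_i(h) = ∞` if `π_i(h) = 0`. -/
def truncation (𝓘 : FractionalIdeal R⁰ (FractionRing R)) (α : ι → ℤ) :
    Submodule R (FractionRing R) where
  carrier := {h | h ∈ 𝓘 ∧ ∀ i, (α i : WithTop ℤ) ≤ branchVal (p i) (projBranch (p i) h)}
  zero_mem' := ⟨FractionalIdeal.zero_mem 𝓘, fun i => by simp [branchVal_zero]⟩
  add_mem' := by
    rintro a b ⟨ha, ha'⟩ ⟨hb, hb'⟩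
    refine ⟨(𝓘 : Submodule R (FractionRing R)).add_mem ha hb, fun i => ?_⟩
    rw [map_add]
    exact le_branchVal_add _ _ _ _ (ha' i) (hb' i)
  smul_mem' := by
    rintro r a ⟨ha, ha'⟩
    refine ⟨(𝓘 : Submodule R (FractionRing R)).smul_mem r ha, fun i => ?_⟩
    rw [Algebra.smul_def, map_mul, projBranch, IsLocalization.map_eq]
    exact le_branchVal_mul _ _ _ _ (ha' i)

end Branches

section Maximals

variable {ι : Type*}

/-- `F_J(A, α)`: the points of `A` with the same coordinates as `α` on `J`, and strictly larger
ones outside `J`. -/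
def fiber (J : Finset ι) (A : Set (ι → ℤ)) (α : ι → ℤ) : Set (ι → ℤ) :=
  {β | β ∈ A ∧ (∀ j ∈ J, β j = α j) ∧ ∀ j ∉ J, α j < β j}

/-- The set `M(A)` of maximal points of `A`. -/
def maximals (A : Set (ι → ℤ)) : Set (ι → ℤ) :=
  {α | α ∈ A ∧ ∀ i, fiber {i} A α = ∅}

/-- The set `AM(A)` of absolute maximal points of `A`. -/
def absoluteMaximals [Fintype ι] (A : Set (ι → ℤ)) : Set (ι → ℤ) :=
  {α | α ∈ maximals A ∧ ∀ J : Finset ι, J.Nonempty → J ≠ Finset.univ → fiber J A α = ∅}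

/-- The set `RM(A)` of relative maximal points of `A`. -/
def relativeMaximals (A : Set (ι → ℤ)) : Set (ι → ℤ) :=
  {α | α ∈ maximals A ∧ ∀ J : Finset ι, 2 ≤ J.card → (fiber J A α).Nonempty}

/-- `c` is the conductor of `A`: the least point with `c + ℕ^ι ⊆ A`. -/
def IsConductor (A : Set (ι → ℤ)) (c : ι → ℤ) : Prop :=
  IsLeast {δ | Set.Ici δ ⊆ A} c

/-- The gaps of a set of integers `A` in the interval `(min A, ∞)`. -/
def gaps (A : Set ℤ) : Set ℤ :=
  {n | n ∉ A ∧ ∃ m ∈ A, m < n}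

end Maximals

/-- A local ring is Cohen-Macaulay if its maximal ideal contains a regular sequence whose
length is the Krull dimension of the ring. -/
def IsCohenMacaulayLocal (R : Type u) [CommRing R] [IsLocalRing R] : Prop :=
  ∃ rs : List R, (∀ x ∈ rs, x ∈ IsLocalRing.maximalIdeal R) ∧
    RingTheory.Sequence.IsRegular R rs ∧ (rs.length : WithBot ℕ∞) = ringKrullDim R

/-- Complete admissible rings: complete, one-dimensional, Noetherian, local, Cohen-Macaulay,
analytically reduced and residually rational rings with at least as many elements in the residue
field as there are minimal primes. -/
structure IsCompleteAdmissible (R : Type u) [CommRing R] [IsLocalRing R] : Prop where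
  noetherian : IsNoetherianRing R
  complete : IsAdicComplete (IsLocalRing.maximalIdeal R) R
  dim_one : ringKrullDim R = 1
  cohenMacaulay : IsCohenMacaulayLocal R
  analyticallyReduced : IsReduced (AdicCompletion (IsLocalRing.maximalIdeal R) R)
  /-- The residue fields of the integral closure of `R` in its total ring of fractions are all
  equal to the residue field of `R`. -/
  residuallyRational : ∀ n : Ideal (integralClosure R (FractionRing R)), n.IsMaximal →
    Function.Surjective
      (algebraMap R (integralClosure R (FractionRing R) ⧸ n))
  residueField_large : (minimalPrimes R).encard ≤ ENat.card (IsLocalRing.ResidueField R)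

end AdmissibleRing

end

/-!
Since `R` is complete, the normalization of each branch `R / ℘ᵢ` is finite, hence a discrete
valuation ring. Residual rationality then makes `𝓘(γ + eᵢ)` either equal to `𝓘(γ)` or maximal in it,
the latter exactly when some `β ∈ E` has `βᵢ = γᵢ` and `β ≥ γ`; so the length depends only on `E`,
and it is counted along any path of unit steps from `α⁰` to `γ`.

Number the coordinates 0, 1, 2 and raise them one after the other. A step `n` in the direction `k`
is missed iff no `β ∈ E` with `βₖ = n` has `βⱼ ≥ γⱼ` for all `j < k`; the gaps of `Eₖ` are always
missed. For `k = 1` the other missed steps are the coordinates `β₁` of the points of `M(E₀₁)`. For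
`k = 2`, the slice `{β ∈ E : β₂ = n}` over such a missed `n ∈ E₂` is a planar staircase: its inner
corners are the relative maximals of height `n`, its outer corners the absolute maximals, and
counting its steps once by inner and once by outer corners gives `#inner + #ends = #outer + 1`. Here
the ends are the directions, at most two, in which the slice is bounded; they correspond to the
points of height `n` in `M(E₀₂)` and `M(E₁₂)`.
-/

namespace AdmissibleRing

open IsLocalRing

section CompleteLocalDomain

theorem isPrecomplete_of_finite {A : Type*} [CommRing A] (I : Ideal A) [IsPrecomplete I A]
    (M : Type*) [AddCommGroup M] [Module A M] [Module.Finite A M] : IsPrecomplete I M := by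
  rw [← AdicCompletion.of_surjective_iff]
  intro y
  obtain ⟨t, rfl⟩ := AdicCompletion.ofTensorProduct_surjective_of_finite I M y
  induction t with
  | zero => exact ⟨0, by simp⟩
  | tmul r x =>
    obtain ⟨r, rfl⟩ := AdicCompletion.of_surjective I A r
    refine ⟨r • x, ?_⟩
    rw [AdicCompletion.ofTensorProduct_tmul, map_smul]
    exact (algebraMap_smul (AdicCompletion I A) r (AdicCompletion.of I M x)).symm
  | add a b ha hb =>
    obtain ⟨a', ha⟩ := ha
    obtain ⟨b', hb⟩ := hb
    exact ⟨a' + b', by rw [map_add, map_add, ha, hb]⟩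

theorem finite_of_fg_sup_smul_top_eq_top {A M : Type*} [CommRing A] {I : Ideal A}
    [IsPrecomplete I A] [AddCommGroup M] [Module A M] [IsHausdorff I M] {B : Submodule A M}
    (hB : B.FG) (h : B ⊔ I • ⊤ = ⊤) : Module.Finite A M := by
  have : Module.Finite A B := Module.Finite.iff_fg.2 hB
  have := isPrecomplete_of_finite I B
  refine Module.Finite.of_surjective B.subtype (surjective_of_mkQ_comp_surjective (I := I) ?_)
  rw [← LinearMap.range_eq_top, LinearMap.range_comp, Submodule.range_subtype,
    Submodule.map_mkQ_eq_top, sup_comm]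
  exact h

theorem exists_isIdempotentElem_sub_mem {V : Type*} [CommRing V] (I : Ideal V)
    [HenselianRing V I] {e : V} (he : e * e - e ∈ I) :
    ∃ a : V, IsIdempotentElem a ∧ a - e ∈ I := by
  open Polynomial in
  have hmonic : (X ^ 2 - X : V[X]).Monic := by
    nontriviality V
    exact (monic_X_pow 2).sub_of_left (by rw [degree_X_pow, degree_X]; norm_num)
  have hidem : Ideal.Quotient.mk I e * Ideal.Quotient.mk I e = Ideal.Quotient.mk I e := by
    rw [← map_mul]
    exact Ideal.Quotient.eq.2 he
  obtain ⟨a, ha, hae⟩ := HenselianRing.is_henselian (I := I) _ hmonic e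
    (by simpa [sq] using he) (by
      refine IsUnit.of_mul_eq_one (2 * Ideal.Quotient.mk I e - 1) ?_
      have hderiv : (derivative (X ^ 2 - X : V[X])).eval e = 2 * e - 1 := by
        simp [one_add_one_eq_two]
      rw [hderiv, map_sub, map_mul, map_one, map_ofNat]
      linear_combination 4 * hidem)
  exact ⟨a, by simpa [IsIdempotentElem, sq, sub_eq_zero] using ha, hae⟩

theorem exists_isIdempotentElem_mul_pow {Q : Type*} [CommRing Q] [IsArtinianRing Q] (v : Q) :
    ∃ (n : ℕ) (y : Q), IsIdempotentElem (v ^ (n + 1) * y) ∧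
      v ^ (n + 1) * (v ^ (n + 1) * y) = v ^ (n + 1) := by
  obtain ⟨n, y, hy⟩ := IsArtinian.exists_pow_succ_smul_dvd v (1 : Q)
  have hy : v ^ n * (v * y) = v ^ n := by
    simp only [smul_eq_mul, mul_one, Nat.succ_eq_add_one] at hy
    linear_combination hy
  have hpow : ∀ k : ℕ, v ^ n * (v * y) ^ k = v ^ n := by
    intro k
    induction k with
    | zero => simp
    | succ k ih => rw [pow_succ, ← mul_assoc, ih, hy]
  have habs : v ^ (n + 1) * (v ^ (n + 1) * y ^ (n + 1)) = v ^ (n + 1) := by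
    rw [← mul_pow, pow_succ v n, mul_right_comm, hpow]
  exact ⟨n, y ^ (n + 1), by rw [IsIdempotentElem]; linear_combination y ^ (n + 1) * habs, habs⟩

theorem isLocalRing_of_henselianRing_of_isArtinianRing_quotient {V : Type*} [CommRing V]
    [IsDomain V] (I : Ideal V) [HenselianRing V I] [IsArtinianRing (V ⧸ I)] : IsLocalRing V := by
  have isUnit_one_sub_of_mem {z : V} (hz : z ∈ Ideal.jacobson (⊥ : Ideal V)) : IsUnit (1 - z) := by
    simpa [sub_eq_neg_add] using Ideal.mem_jacobson_bot.1 hz (-1)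
  refine IsLocalRing.of_isUnit_or_isUnit_one_sub_self fun v => ?_
  obtain ⟨n, y, hidem, habs⟩ := exists_isIdempotentElem_mul_pow (Ideal.Quotient.mk I v)
  obtain ⟨y, rfl⟩ := Ideal.Quotient.mk_surjective y
  simp only [IsIdempotentElem, ← map_pow, ← map_mul, Ideal.Quotient.eq] at hidem habs
  obtain ⟨a, ha, hae⟩ := exists_isIdempotentElem_sub_mem I hidem
  rcases IsIdempotentElem.iff_eq_zero_or_one.1 ha with rfl | rfl
  · right
    have hmem : v ^ (n + 1) ∈ I := by
      have := I.sub_mem (I.mul_mem_left (-v ^ (n + 1)) hae) habs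
      ring_nf at this ⊢
      exact this
    exact isUnit_one_sub_of_mem (Ideal.isRadical_jacobson _ ⟨n + 1, HenselianRing.jac hmem⟩)
  · left
    have := isUnit_one_sub_of_mem (HenselianRing.jac hae)
    rw [sub_sub_cancel, pow_succ', mul_assoc] at this
    exact isUnit_of_mul_isUnit_left this

theorem isAdicComplete_of_finite {A : Type*} [CommRing A] [IsLocalRing A] [IsNoetherianRing A]
    [IsAdicComplete (maximalIdeal A) A] (M : Type*) [AddCommGroup M] [Module A M]
    [Module.Finite A M] : IsAdicComplete (maximalIdeal A) M :=
  { isPrecomplete_of_finite (maximalIdeal A) M with toIsHausdorff := inferInstance }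

theorem isLocalRing_of_finite_of_isAdicComplete (A : Type*) {V : Type*} [CommRing A]
    [IsLocalRing A] [IsNoetherianRing A] [IsAdicComplete (maximalIdeal A) A] [CommRing V]
    [IsDomain V] [Algebra A V] [Module.Finite A V] : IsLocalRing V := by
  let I := (maximalIdeal A).map (algebraMap A V)
  have : IsAdicComplete I V :=
    (IsAdicComplete.map_algebraMap_iff _ _).2 (isAdicComplete_of_finite V)
  have : Module.Finite (A ⧸ maximalIdeal A) (V ⧸ I) :=
    Module.Finite.of_restrictScalars_finite A _ _
  have : IsArtinianRing (A ⧸ maximalIdeal A) :=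
    inferInstanceAs (IsArtinianRing (ResidueField A))
  have : IsArtinianRing (V ⧸ I) := IsArtinianRing.of_finite (A ⧸ maximalIdeal A) (V ⧸ I)
  exact isLocalRing_of_henselianRing_of_isArtinianRing_quotient I

theorem exists_maximalIdeal_pow_le_span_singleton {A : Type*} [CommRing A]
    [IsLocalRing A] [IsNoetherianRing A] [Ring.DimensionLEOne A] {a : A} (ha : a ≠ 0) :
    ∃ n, maximalIdeal A ^ n ≤ Ideal.span {a} := by
  refine Ideal.exists_pow_le_of_le_radical_of_fg ?_ (IsNoetherian.noetherian _)
  rw [Ideal.radical_eq_sInf]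
  refine le_sInf fun P ⟨haP, hP⟩ => ?_
  have : P.IsMaximal :=
    hP.isMaximal ((Submodule.ne_bot_iff _).2 ⟨a, haP (Ideal.mem_span_singleton_self a), ha⟩)
  exact (eq_maximalIdeal this).ge

theorem exists_pow_smul_eq_algebraMap {A K : Type*} [CommRing A] [IsLocalRing A]
    [IsNoetherianRing A] [Ring.DimensionLEOne A] [Field K] [Algebra A K] [IsFractionRing A K]
    {x : A} (hx : x ∈ maximalIdeal A) (y : K) :
    ∃ (n : ℕ) (a : A), x ^ n • y = algebraMap A K a := by
  obtain ⟨a, b, hb, rfl⟩ := IsFractionRing.div_surjective A y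
  obtain ⟨n, hn⟩ := exists_maximalIdeal_pow_le_span_singleton (nonZeroDivisors.ne_zero hb)
  obtain ⟨c, hc⟩ := Ideal.mem_span_singleton'.1 (hn (Ideal.pow_mem_pow hx n))
  have hb0 : algebraMap A K b ≠ 0 := IsFractionRing.to_map_ne_zero_of_mem_nonZeroDivisors hb
  refine ⟨n, c * a, ?_⟩
  rw [← hc, Algebra.smul_def, map_mul, map_mul, mul_assoc, mul_div_cancel₀ _ hb0]

open scoped Pointwise in
theorem exists_algebraMap_eq_pow_succ_smul_add {A K : Type*} [CommRing A]
    [IsDomain A] [IsNoetherianRing A] [Ring.DimensionLEOne A] [CommRing K] [Algebra A K] {x : A}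
    (hx0 : x ≠ 0) (V : Submodule A K) :
    ∃ N, ∀ n ≥ N, ∀ a, ∀ v ∈ V, algebraMap A K a = x ^ n • v →
      ∃ b, ∃ w ∈ V, algebraMap A K a = x ^ (n + 1) • w + x • algebraMap A K b := by
  have : IsArtinian A (A ⧸ Ideal.span {x}) := (isFiniteLength_iff_isNoetherian_isArtinian.1
    (isFiniteLength_quotient_span_singleton A (mem_nonZeroDivisors_of_ne_zero hx0))).2
  let I (n : ℕ) : Submodule A A := (x ^ n • V).comap (Algebra.linearMap A K)
  have antitone_I : Antitone I := antitone_nat_of_succ_le fun n => Submodule.comap_mono <| by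
    rintro _ ⟨v, hv, rfl⟩
    exact ⟨x • v, V.smul_mem x hv, by simp [pow_succ, mul_smul, smul_comm x (x ^ n)]⟩
  -- As for Krull–Akizuki: the images of the ideals `A ∩ xⁿV` in the Artinian `A / x` stabilize.
  let q : A →ₗ[A] A ⧸ Ideal.span {x} := (Ideal.span {x}).mkQ
  obtain ⟨N, hN⟩ := IsArtinian.monotone_stabilizes (R := A)
    ⟨fun n => OrderDual.toDual ((I n).map q), fun _ _ hmn => Submodule.map_mono (antitone_I hmn)⟩
  refine ⟨N, fun n hn a v hv hav => ?_⟩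
  have heq : (I n).map q = (I (n + 1)).map q :=
    (hN n hn).symm.trans (hN (n + 1) (hn.trans n.le_succ))
  have ha : a ∈ I n := ⟨v, hv, hav.symm⟩
  obtain ⟨c, ⟨w, hw, hwc⟩, hca⟩ := heq.le (Submodule.mem_map_of_mem ha)
  obtain ⟨b, hb⟩ := Ideal.mem_span_singleton'.1 (Ideal.Quotient.eq.1 hca.symm)
  have hwc : x ^ (n + 1) • w = algebraMap A K c := hwc
  refine ⟨b, w, hw, ?_⟩
  rw [hwc, ← sub_eq_iff_eq_add', ← map_sub, ← hb, map_mul, Algebra.smul_def, mul_comm]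

variable {A K : Type*} [CommRing A] [IsDomain A] [IsLocalRing A] [IsNoetherianRing A]
  [Ring.DimensionLEOne A] [Field K] [Algebra A K] [IsFractionRing A K]

theorem exists_pow_smul_eq_algebraMap_add {x : A} (hx : x ∈ maximalIdeal A) (hx0 : x ≠ 0)
    (V : Submodule A K) :
    ∃ N, ∀ v ∈ V, ∃ a, ∃ w ∈ V, x ^ N • v = algebraMap A K a + x ^ (N + 1) • w := by
  have hxK : algebraMap A K x ≠ 0 := (map_ne_zero_iff _ (IsFractionRing.injective A K)).2 hx0
  obtain ⟨N, hN⟩ := exists_algebraMap_eq_pow_succ_smul_add hx0 V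
  refine ⟨N, fun v hv => ?_⟩
  obtain ⟨k, a, hk⟩ := exists_pow_smul_eq_algebraMap hx v
  refine Nat.decreasingInduction' (n := N + k)
    (P := fun n => ∃ a, ∃ w ∈ V, x ^ n • v = algebraMap A K a + x ^ (n + 1) • w)
    (fun n _ hn ⟨a, w, hw, haw⟩ => ?_) (Nat.le_add_right N k)
    ⟨x ^ N * a, 0, V.zero_mem, by rw [pow_add, mul_smul, hk]; simp [Algebra.smul_def]⟩
  obtain ⟨b, u, hu, hbu⟩ := hN (n + 1) (hn.trans n.le_succ) a (v - x • w)
    (V.sub_mem hv (V.smul_mem x hw)) (by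
      rw [smul_sub, haw, ← mul_smul, ← pow_succ, add_sub_cancel_right])
  refine ⟨b, w + u, V.add_mem hw hu, mul_left_cancel₀ hxK ?_⟩
  rw [hbu] at haw
  simp only [Algebra.smul_def, map_pow] at haw ⊢
  linear_combination haw

theorem exists_fg_forall_eq_add_smul {x : A} (hx : x ∈ maximalIdeal A) (hx0 : x ≠ 0)
    (V : Submodule A K) :
    ∃ B : Submodule A V, B.FG ∧ ∀ v : V, ∃ b ∈ B, ∃ w : V, v = b + x • w := by
  have hxK : algebraMap A K x ≠ 0 := (map_ne_zero_iff _ (IsFractionRing.injective A K)).2 hx0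
  obtain ⟨N, hN⟩ := exists_pow_smul_eq_algebraMap_add hx hx0 V
  let scale : V →ₗ[A] K := LinearMap.lsmul A K (x ^ N) ∘ₗ V.subtype
  have injective_scale : Function.Injective scale := fun v w hvw => Subtype.ext <|
    mul_left_cancel₀ (pow_ne_zero N hxK) (by simpa [scale, Algebra.smul_def] using hvw)
  let B := (LinearMap.range (Algebra.linearMap A K)).comap scale
  have hB : Module.Finite A B := Module.Finite.of_injective
    (scale.restrict (p := B) (q := LinearMap.range (Algebra.linearMap A K)) fun _ hb => hb)
    fun b c hbc => Subtype.ext (injective_scale (congrArg Subtype.val hbc))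
  refine ⟨B, Module.Finite.iff_fg.1 hB, fun v => ?_⟩
  obtain ⟨a, w, hw, haw⟩ := hN v v.2
  refine ⟨v - x • ⟨w, hw⟩, ⟨a, ?_⟩, ⟨w, hw⟩, (sub_add_cancel v _).symm⟩
  simp [scale, smul_sub, haw, pow_succ, mul_smul]

theorem isHausdorff_integralClosure (hA : ¬ IsField A) :
    IsHausdorff (maximalIdeal A) (integralClosure A K) := by
  obtain ⟨x, hx, hx0⟩ := Submodule.exists_mem_ne_zero_of_ne_bot
    (mt isField_iff_maximalIdeal_eq.2 hA)
  obtain ⟨N, hN⟩ := exists_maximalIdeal_pow_le_span_singleton hx0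
  refine ⟨fun v hv => by_contra fun hv0 => ?_⟩
  have hdiv (n : ℕ) : ∃ w : integralClosure A K, v = x ^ n • w := by
    have hle : maximalIdeal A ^ (N * n) ≤ Ideal.span {x ^ n} := by
      rw [pow_mul, ← Ideal.span_singleton_pow]
      exact Ideal.pow_right_mono hN n
    have hmem := Submodule.smul_mono_left hle (SModEq.zero.1 (hv (N * n)))
    rw [Submodule.ideal_span_singleton_smul] at hmem
    obtain ⟨w, -, hw⟩ := hmem
    exact ⟨w, hw.symm⟩
  have hvK : (v : K) ≠ 0 := fun h => hv0 (Subtype.ext h)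
  obtain ⟨n, a, ha⟩ := exists_pow_smul_eq_algebraMap hx (v : K)⁻¹
  obtain ⟨w, hw⟩ := hdiv (n + 1)
  have hxK : algebraMap A K x ≠ 0 := (map_ne_zero_iff _ (IsFractionRing.injective A K)).2 hx0
  have hunit : algebraMap A (integralClosure A K) x * (algebraMap A _ a * w) = 1 := by
    have hw : (v : K) = algebraMap A K x ^ (n + 1) * w := by
      rw [hw, ← map_pow, ← Algebra.smul_def]; rfl
    refine Subtype.ext (?_ : algebraMap A K x * (algebraMap A K a * w) = 1)
    rw [← ha, Algebra.smul_def, map_pow]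
    rw [hw] at hvK ⊢
    have := right_ne_zero_of_mul hvK
    field_simp
    rw [pow_succ']
  exact (mem_maximalIdeal _).1 hx
    (isUnit_of_map_unit (algebraMap A (integralClosure A K)) _ (.of_mul_eq_one _ hunit))

variable [IsAdicComplete (maximalIdeal A) A]

theorem finite_integralClosure_of_isAdicComplete (hA : ¬ IsField A) :
    Module.Finite A (integralClosure A K) := by
  obtain ⟨x, hx, hx0⟩ := Submodule.exists_mem_ne_zero_of_ne_bot
    (mt isField_iff_maximalIdeal_eq.2 hA)
  have : IsHausdorff (maximalIdeal A) (integralClosure A K) := isHausdorff_integralClosure hA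
  obtain ⟨B, hB, hadd⟩ := exists_fg_forall_eq_add_smul hx hx0
    (Subalgebra.toSubmodule (integralClosure A K))
  refine finite_of_fg_sup_smul_top_eq_top (I := maximalIdeal A) hB (eq_top_iff.2 fun v _ => ?_)
  obtain ⟨b, hb, w, rfl⟩ := hadd v
  exact Submodule.add_mem_sup hb (Submodule.smul_mem_smul hx trivial)

theorem isDiscreteValuationRing_integralClosure_of_isAdicComplete (hA : ¬ IsField A) :
    IsDiscreteValuationRing (integralClosure A K) := by
  have := finite_integralClosure_of_isAdicComplete (K := K) hA
  have : IsLocalRing (integralClosure A K) := isLocalRing_of_finite_of_isAdicComplete A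
  have : IsNoetherianRing (integralClosure A K) := IsNoetherianRing.of_finite A _
  have : IsIntegrallyClosed (integralClosure A K) :=
    integralClosure.isIntegrallyClosedOfFiniteExtension K
  have : IsDedekindDomain (integralClosure A K) := { }
  have hfield : ¬ IsField (integralClosure A K) := fun h => hA (isField_of_isIntegral_of_isField
    (FaithfulSMul.algebraMap_injective A (integralClosure A K)) h)
  exact ((IsDiscreteValuationRing.TFAE _ hfield).out 0 2).2 this

end CompleteLocalDomain

section Branch

variable {R : Type*} [CommRing R] (P : minimalPrimes R)

theorem dimensionLEOne_branch (hR : ringKrullDim R ≤ 1) : Ring.DimensionLEOne (Branch P) := by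
  have : Ring.KrullDimLE 1 (Branch P) :=
    Ring.krullDimLE_iff.2 ((ringKrullDim_quotient_le P.1).trans hR)
  exact ⟨fun hq0 hq => hq.isMaximal_of_ne_bot hq0⟩

variable [IsLocalRing R]

scoped instance isLocalRing_branch : IsLocalRing (Branch P) :=
  .of_surjective' (Ideal.Quotient.mk P.1) Ideal.Quotient.mk_surjective

theorem maximalIdeal_branch :
    maximalIdeal (Branch P) = (maximalIdeal R).map (Ideal.Quotient.mk P.1) :=
  (map_maximalIdeal_of_surjective _ Ideal.Quotient.mk_surjective).symm

theorem isAdicComplete_branch [IsNoetherianRing R] [IsAdicComplete (maximalIdeal R) R] :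
    IsAdicComplete (maximalIdeal (Branch P)) (Branch P) := by
  rw [maximalIdeal_branch]
  exact (IsAdicComplete.map_algebraMap_iff _ _).2 (isAdicComplete_of_finite (Branch P))

theorem not_isField_branch {x : R} (hxm : x ∈ maximalIdeal R) (hx : x ∈ R⁰) :
    ¬ IsField (Branch P) := by
  rw [isField_iff_maximalIdeal_eq, maximalIdeal_branch]
  intro h
  exact nonZeroDivisors.ne_zero (nonZeroDivisors_le_comap_branch P hx)
    (h.le (Ideal.mem_map_of_mem (Ideal.Quotient.mk P.1) hxm))

end Branch

namespace IsCompleteAdmissible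

variable {R : Type*} [CommRing R] [IsLocalRing R]

theorem finite_minimalPrimes (hR : IsCompleteAdmissible R) : Finite (minimalPrimes R) :=
  have := hR.noetherian
  (minimalPrimes.finite_of_isNoetherianRing R).to_subtype

theorem isReduced (hR : IsCompleteAdmissible R) : IsReduced R := by
  have := hR.complete
  have := hR.analyticallyReduced
  exact isReduced_of_injective (algebraMap R (AdicCompletion (maximalIdeal R) R))
    (AdicCompletion.of_injective (maximalIdeal R) R)

theorem exists_mem_nonZeroDivisors (hR : IsCompleteAdmissible R) :
    ∃ x ∈ maximalIdeal R, x ∈ R⁰ := by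
  obtain ⟨rs, hrs, hreg, hlen⟩ := hR.cohenMacaulay
  rw [hR.dim_one] at hlen
  obtain ⟨x, rfl⟩ := List.length_eq_one_iff.1 (by exact_mod_cast hlen)
  have hx := (RingTheory.Sequence.isWeaklyRegular_singleton_iff R x).1 hreg.toIsWeaklyRegular
  refine ⟨x, hrs x (by simp), mem_nonZeroDivisors_iff_right.2 fun z hz => hx ?_⟩
  simpa [mul_comm] using hz

theorem finite_branchNormalization (hR : IsCompleteAdmissible R) (P : minimalPrimes R) :
    Module.Finite (Branch P) (BranchNormalization P) := by
  have := hR.noetherian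
  have := hR.complete
  have := isAdicComplete_branch P
  have := dimensionLEOne_branch P hR.dim_one.le
  obtain ⟨x, hxm, hx⟩ := hR.exists_mem_nonZeroDivisors
  exact finite_integralClosure_of_isAdicComplete (not_isField_branch P hxm hx)

theorem isDiscreteValuationRing_branchNormalization (hR : IsCompleteAdmissible R)
    (P : minimalPrimes R) : IsDiscreteValuationRing (BranchNormalization P) := by
  have := hR.noetherian
  have := hR.complete
  have := isAdicComplete_branch P
  have := dimensionLEOne_branch P hR.dim_one.le
  obtain ⟨x, hxm, hx⟩ := hR.exists_mem_nonZeroDivisors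
  exact isDiscreteValuationRing_integralClosure_of_isAdicComplete (not_isField_branch P hxm hx)

end IsCompleteAdmissible

section JointlyInjective

variable {A ι : Type*} [CommRing A] {B : ι → Type*} [∀ i, CommRing (B i)]

theorem mem_nonZeroDivisors_of_forall_map_ne_zero [∀ i, IsDomain (B i)] (f : ∀ i, A →+* B i)
    (hf : ∀ z, (∀ i, f i z = 0) → z = 0) {a : A} (ha : ∀ i, f i a ≠ 0) : a ∈ A⁰ := by
  refine mem_nonZeroDivisors_iff_right.2 fun z hz => hf z fun i => ?_
  refine (mul_eq_zero.1 ?_).resolve_right (ha i)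
  rw [← map_mul, hz, map_zero]

theorem isIntegral_of_forall_isIntegral_map {R : Type*} [CommRing R] [Algebra R A]
    [∀ i, Algebra R (B i)] [Finite ι] (f : ∀ i, A →ₐ[R] B i)
    (hf : ∀ z, (∀ i, f i z = 0) → z = 0) {a : A} (ha : ∀ i, IsIntegral R (f i a)) :
    IsIntegral R a := by
  have := Fintype.ofFinite ι
  choose g hg hga using ha
  refine ⟨∏ i, g i, Polynomial.monic_prod_of_monic _ _ fun i _ => hg i, hf _ fun i => ?_⟩
  rw [← Polynomial.aeval_def, ← Polynomial.aeval_algHom_apply, map_prod]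
  exact Finset.prod_eq_zero (Finset.mem_univ i) (hga i)

end JointlyInjective

section MinimalPrimes

variable {R : Type*} [CommRing R]

theorem exists_notMem_and_forall_ne_mem [Finite (minimalPrimes R)] (P : minimalPrimes R) :
    ∃ r, r ∉ P.1 ∧ ∀ Q : minimalPrimes R, Q ≠ P → r ∈ Q.1 := by
  classical
  have := Fintype.ofFinite (minimalPrimes R)
  have hP : P.1.IsPrime := P.2.1.1
  have hnle : ¬ (Finset.univ.erase P).inf (fun Q : minimalPrimes R => Q.1) ≤ P.1 := by
    rw [hP.inf_le']
    rintro ⟨Q, hQ, hQP⟩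
    exact Finset.ne_of_mem_erase hQ (Subtype.ext (hQP.antisymm (P.2.2 Q.2.1 hQP)))
  obtain ⟨r, hr, hrP⟩ := SetLike.not_le_iff_exists.1 hnle
  refine ⟨r, hrP, fun Q hQ => ?_⟩
  exact Finset.inf_le (f := fun Q : minimalPrimes R => Q.1)
    (Finset.mem_erase.2 ⟨hQ, Finset.mem_univ Q⟩) hr

theorem eq_zero_of_forall_mem_minimalPrimes [IsReduced R] {r : R}
    (hr : ∀ P : minimalPrimes R, r ∈ P.1) : r = 0 := by
  have hr : r ∈ sInf (minimalPrimes R) := Ideal.mem_sInf.2 fun {P} hP => hr ⟨P, hP⟩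
  rw [minimalPrimes, Ideal.sInf_minimalPrimes] at hr
  exact IsReduced.eq_zero r hr

theorem mem_nonZeroDivisors_of_forall_notMem_minimalPrimes [IsReduced R] {r : R}
    (hr : ∀ P : minimalPrimes R, r ∉ P.1) : r ∈ R⁰ :=
  mem_nonZeroDivisors_of_forall_map_ne_zero (fun P : minimalPrimes R => Ideal.Quotient.mk P.1)
    (fun _ hz => eq_zero_of_forall_mem_minimalPrimes fun P =>
      Ideal.Quotient.eq_zero_iff_mem.1 (hz P))
    fun P => mt Ideal.Quotient.eq_zero_iff_mem.1 (hr P)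

end MinimalPrimes

section TotalFractions

variable {R : Type*} [CommRing R]

/-- The projection `π_P : K → K_P` as a homomorphism of `R`-algebras. -/
noncomputable def projBranchAlgHom (P : minimalPrimes R) : FractionRing R →ₐ[R] BranchField P :=
  { projBranch P with commutes' := fun _ => IsLocalization.map_eq _ _ }

theorem projBranch_algebraMap (P : minimalPrimes R) (r : R) :
    projBranch P (algebraMap R (FractionRing R) r) = algebraMap R (BranchField P) r :=
  (projBranchAlgHom P).commutes r

theorem projBranch_smul (P : minimalPrimes R) (r : R) (h : FractionRing R) :
    projBranch P (r • h) = r • projBranch P h :=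
  map_smul (projBranchAlgHom P) r h

theorem algebraMap_branchField_eq_zero_iff (P : minimalPrimes R) (r : R) :
    algebraMap R (BranchField P) r = 0 ↔ r ∈ P.1 := by
  rw [IsScalarTower.algebraMap_apply R (Branch P), map_eq_zero_iff _ (IsFractionRing.injective _ _)]
  exact Ideal.Quotient.eq_zero_iff_mem

theorem exists_mul_algebraMap_eq_algebraMap (P : minimalPrimes R) (x : BranchField P) :
    ∃ a b : R, algebraMap R (BranchField P) b ≠ 0 ∧
      x * algebraMap R (BranchField P) b = algebraMap R (BranchField P) a := by
  obtain ⟨⟨a, b, hb⟩, hab⟩ := IsLocalization.surj (Branch P)⁰ x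
  obtain ⟨a, rfl⟩ := Ideal.Quotient.mk_surjective a
  obtain ⟨b, rfl⟩ := Ideal.Quotient.mk_surjective b
  exact ⟨a, b, IsFractionRing.to_map_ne_zero_of_mem_nonZeroDivisors (R := Branch P) hb, hab⟩

theorem projBranch_algebraMap_ne_zero (P : minimalPrimes R) {r : R} (hr : r ∈ R⁰) :
    projBranch P (algebraMap R (FractionRing R) r) ≠ 0 := by
  rw [projBranch_algebraMap, Ne, algebraMap_branchField_eq_zero_iff]
  exact fun h => notMem_nonZeroDivisors_of_mem_mem_minimalPrimes h P.2 hr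

variable [IsReduced R]

theorem eq_zero_of_forall_projBranch_eq_zero {h : FractionRing R}
    (hh : ∀ P : minimalPrimes R, projBranch P h = 0) : h = 0 := by
  obtain ⟨a, s, rfl⟩ := IsLocalization.exists_mk'_eq R⁰ h
  suffices a = 0 by rw [this, IsLocalization.mk'_zero]
  refine eq_zero_of_forall_mem_minimalPrimes fun P => ?_
  rw [← algebraMap_branchField_eq_zero_iff, ← projBranch_algebraMap,
    ← IsLocalization.mk'_spec (FractionRing R) a s, map_mul, hh, zero_mul]

theorem exists_forall_projBranch_eq [Finite (minimalPrimes R)]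
    (x : ∀ P : minimalPrimes R, BranchField P) :
    ∃ h : FractionRing R, ∀ P, projBranch P h = x P := by
  have := Fintype.ofFinite (minimalPrimes R)
  choose r hr hr' using exists_notMem_and_forall_ne_mem (R := R)
  choose a b hb hab using fun P => exists_mul_algebraMap_eq_algebraMap P (x P)
  have algebraMap_sum (c : minimalPrimes R → R) (P : minimalPrimes R) :
      algebraMap R (BranchField P) (∑ Q, c Q * r Q) =
        algebraMap R (BranchField P) (c P) * algebraMap R (BranchField P) (r P) := by
    rw [map_sum, Finset.sum_eq_single P (fun Q _ hQ => ?_) (by simp), map_mul]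
    rw [map_mul, (algebraMap_branchField_eq_zero_iff P (r Q)).2 (hr' Q P hQ.symm), mul_zero]
  have hs (P : minimalPrimes R) : algebraMap R (BranchField P) (∑ Q, b Q * r Q) ≠ 0 := by
    rw [algebraMap_sum]
    exact mul_ne_zero (hb P) (mt (algebraMap_branchField_eq_zero_iff P (r P)).1 (hr P))
  let s : R⁰ := ⟨∑ Q, b Q * r Q, mem_nonZeroDivisors_of_forall_notMem_minimalPrimes fun P =>
    mt (algebraMap_branchField_eq_zero_iff P _).2 (hs P)⟩
  refine ⟨IsLocalization.mk' _ (∑ Q, a Q * r Q) s, fun P => mul_right_cancel₀ (hs P) ?_⟩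
  rw [← projBranch_algebraMap, ← map_mul, IsLocalization.mk'_spec _ _ s,
    projBranch_algebraMap, projBranch_algebraMap, algebraMap_sum, algebraMap_sum, ← mul_assoc, hab]

theorem isIntegral_iff_forall_projBranch_mem [Finite (minimalPrimes R)] {h : FractionRing R} :
    IsIntegral R h ↔ ∀ P : minimalPrimes R, projBranch P h ∈ BranchNormalization P :=
  ⟨fun hh P => (hh.map (projBranchAlgHom P)).tower_top, fun hh =>
    isIntegral_of_forall_isIntegral_map projBranchAlgHom
      (fun _ => eq_zero_of_forall_projBranch_eq_zero) fun P => isIntegral_trans _ (hh P)⟩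

end TotalFractions

theorem isLocalHom_algebraMap_integralClosure (A K : Type*) [CommRing A] [IsDomain A] [Field K]
    [Algebra A K] [IsFractionRing A K] : IsLocalHom (algebraMap A (integralClosure A K)) :=
  (algebraMap_isIntegral_iff.2 integralClosure.AlgebraIsIntegral).isLocalHom
    (FaithfulSMul.algebraMap_injective _ _)

section DVR

variable (A : Type*) {K : Type*} [CommRing A] [IsDomain A] [IsDiscreteValuationRing A] [Field K]
  [Algebra A K] [IsFractionRing A K]

theorem dvrVal_eq_top_iff (x : K) : dvrVal A K x = ⊤ ↔ x = 0 := by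
  by_cases h : x = 0 <;> simp [dvrVal, h]

theorem dvrVal_mul (x y : K) : dvrVal A K (x * y) = dvrVal A K x + dvrVal A K y := by
  by_cases hx : x = 0
  · simp [dvrVal, hx]
  by_cases hy : y = 0
  · simp [dvrVal, hy]
  rw [dvrVal, dvrVal, dvrVal, if_neg hx, if_neg hy, if_neg (mul_ne_zero hx hy), map_mul,
    WithZero.log_mul ((Valuation.ne_zero_iff _).2 hx) ((Valuation.ne_zero_iff _).2 hy), neg_add,
    WithTop.coe_add]

theorem zero_le_dvrVal_iff (x : K) : 0 ≤ dvrVal A K x ↔ ∃ a, algebraMap A K a = x := by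
  rw [← WithTop.coe_zero, le_dvrVal_iff, neg_zero, WithZero.exp_zero]
  refine ⟨IsDiscreteValuationRing.exists_lift_of_le_one, ?_⟩
  rintro ⟨a, rfl⟩
  exact (IsDiscreteValuationRing.maximalIdeal A).valuation_le_one a

theorem one_le_dvrVal_algebraMap_iff (a : A) :
    1 ≤ dvrVal A K (algebraMap A K a) ↔ a ∈ maximalIdeal A := by
  rw [← WithTop.coe_one, le_dvrVal_iff, IsDedekindDomain.HeightOneSpectrum.valuation_of_algebraMap]
  have h := (IsDiscreteValuationRing.maximalIdeal A).intValuation_le_pow_iff_mem a 1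
  rwa [pow_one] at h

theorem dvrVal_surjective : Function.Surjective (dvrVal A K) := by
  intro n
  induction n with
  | top => exact ⟨0, (dvrVal_eq_top_iff A 0).2 rfl⟩
  | coe n =>
    obtain ⟨π, hπ⟩ := (IsDiscreteValuationRing.maximalIdeal A).valuation_exists_uniformizer K
    have hπ0 : π ≠ 0 := by
      rintro rfl
      exact WithZero.exp_ne_zero (hπ.symm.trans (map_zero _))
    refine ⟨π ^ n, ?_⟩
    rw [dvrVal, if_neg (zpow_ne_zero n hπ0), map_zpow₀, hπ, WithZero.log_zpow]
    simp

end DVR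

section BranchVal

variable {R : Type*} [CommRing R] {P : minimalPrimes R}
  [hP : IsDiscreteValuationRing (BranchNormalization P)]

theorem branchVal_eq_dvrVal : branchVal P = dvrVal (BranchNormalization P) (BranchField P) :=
  funext fun _ => dif_pos hP

theorem branchVal_eq_top_iff {x : BranchField P} : branchVal P x = ⊤ ↔ x = 0 := by
  rw [branchVal_eq_dvrVal, dvrVal_eq_top_iff]

theorem branchVal_mul (x y : BranchField P) :
    branchVal P (x * y) = branchVal P x + branchVal P y := by
  rw [branchVal_eq_dvrVal, dvrVal_mul]

theorem zero_le_branchVal_iff {x : BranchField P} :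
    0 ≤ branchVal P x ↔ x ∈ BranchNormalization P := by
  rw [branchVal_eq_dvrVal, zero_le_dvrVal_iff]
  exact ⟨by rintro ⟨a, rfl⟩; exact a.2, fun h => ⟨⟨x, h⟩, rfl⟩⟩

theorem one_le_branchVal_iff {v : BranchNormalization P} :
    1 ≤ branchVal P v ↔ v ∈ maximalIdeal (BranchNormalization P) := by
  rw [branchVal_eq_dvrVal]
  exact one_le_dvrVal_algebraMap_iff (BranchNormalization P) v

theorem branchVal_surjective : Function.Surjective (branchVal P) := by
  rw [branchVal_eq_dvrVal]
  exact dvrVal_surjective _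

theorem one_le_branchVal_algebraMap [IsLocalRing R] {r : R} (hr : r ∈ maximalIdeal R) :
    1 ≤ branchVal P (algebraMap R (BranchField P) r) := by
  have hrP : Ideal.Quotient.mk P.1 r ∈ maximalIdeal (Branch P) := by
    rw [maximalIdeal_branch]
    exact Ideal.mem_map_of_mem _ hr
  have := isLocalHom_algebraMap_integralClosure (Branch P) (BranchField P)
  exact one_le_branchVal_iff.2 (map_nonunit (algebraMap (Branch P) (BranchNormalization P)) _ hrP)

end BranchVal

section ResidualRationality

variable {R : Type*} [CommRing R]

/-- The projection from the integral closure of `R` in its total ring of fractions to the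
normalization of the branch at `P`. -/
noncomputable def projNormalization (P : minimalPrimes R) :
    integralClosure R (FractionRing R) →ₐ[R] BranchNormalization P :=
  ((projBranchAlgHom P).comp (integralClosure R (FractionRing R)).val).codRestrict
    ((BranchNormalization P).restrictScalars R)
    fun h => (h.2.map (projBranchAlgHom P)).tower_top

theorem projNormalization_surjective [Finite (minimalPrimes R)] [IsReduced R]
    (P : minimalPrimes R) : Function.Surjective (projNormalization P) := by
  classical
  intro v
  obtain ⟨h, hh⟩ := exists_forall_projBranch_eq (Pi.single P (v : BranchField P))
  refine ⟨⟨h, isIntegral_iff_forall_projBranch_mem.2 fun Q => ?_⟩,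
    Subtype.ext ((hh P).trans (Pi.single_eq_same P _))⟩
  rw [hh]
  rcases eq_or_ne Q P with rfl | hQ
  · rw [Pi.single_eq_same]
    exact v.2
  · rw [Pi.single_eq_of_ne hQ]
    exact zero_mem _

variable [IsLocalRing R]

theorem IsCompleteAdmissible.exists_sub_algebraMap_mem_maximalIdeal (hR : IsCompleteAdmissible R)
    {P : minimalPrimes R} [IsLocalRing (BranchNormalization P)] (v : BranchNormalization P) :
    ∃ r : R, v - algebraMap R (BranchNormalization P) r ∈ maximalIdeal (BranchNormalization P) := by
  have := hR.isReduced
  have := hR.finite_minimalPrimes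
  have hsurj := projNormalization_surjective P
  obtain ⟨h, rfl⟩ := hsurj v
  have hmax : ((maximalIdeal (BranchNormalization P)).comap (projNormalization P)).IsMaximal :=
    Ideal.comap_isMaximal_of_surjective (projNormalization P) hsurj
  obtain ⟨r, hr⟩ := hR.residuallyRational _ hmax (Ideal.Quotient.mk _ h)
  have hhr := Ideal.mem_comap.1 (Ideal.Quotient.eq.1 hr.symm)
  rw [map_sub, AlgHom.commutes] at hhr
  exact ⟨r, hhr⟩

theorem IsCompleteAdmissible.exists_le_branchVal_sub_smul (hR : IsCompleteAdmissible R)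
    {P : minimalPrimes R} {n : ℤ} {x y : BranchField P} (hy : branchVal P y = n)
    (hx : n ≤ branchVal P x) : ∃ r : R, ((n + 1 : ℤ) : WithTop ℤ) ≤ branchVal P (x - r • y) := by
  have := hR.isDiscreteValuationRing_branchNormalization P
  have hy0 : y ≠ 0 := fun h => WithTop.coe_ne_top (hy.symm.trans (branchVal_eq_top_iff.2 h))
  have hxy : x / y ∈ BranchNormalization P := by
    rw [← div_mul_cancel₀ x hy0, branchVal_mul, hy] at hx
    refine zero_le_branchVal_iff.1 (WithTop.le_of_add_le_add_right (WithTop.coe_ne_top (a := n)) ?_)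
    rwa [zero_add]
  obtain ⟨r, hr⟩ := hR.exists_sub_algebraMap_mem_maximalIdeal (⟨x / y, hxy⟩ : BranchNormalization P)
  have hmul : x - r • y = (x / y - algebraMap R (BranchField P) r) * y := by
    rw [sub_mul, div_mul_cancel₀ x hy0, Algebra.smul_def]
  refine ⟨r, ?_⟩
  rw [hmul, branchVal_mul, hy, add_comm n, WithTop.coe_add]
  exact add_le_add (one_le_branchVal_iff.2 hr) le_rfl

end ResidualRationality

/-- A family `w` of functions on an `R`-module with the formal properties of the valuations of the
branches of an admissible ring: they are compatible with the module structure, residually rational,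
and independent of each other. The bounds are by integers, so that nothing has to be said about
sums with the value `⊤`. -/
structure IsValuationFamily (R : Type*) {K ι : Type*} [CommRing R] [IsLocalRing R]
    [AddCommGroup K] [Module R K] (w : ι → K → WithTop ℤ) : Prop where
  le_add : ∀ i (n : ℤ) x y, n ≤ w i x → n ≤ w i y → n ≤ w i (x + y)
  le_smul : ∀ i (n : ℤ) (r : R) x, n ≤ w i x → n ≤ w i (r • x)
  le_smul_of_mem : ∀ i (n : ℤ) (r : R) x, r ∈ maximalIdeal R → n ≤ w i x →
    (n + 1 : ℤ) ≤ w i (r • x)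
  exists_le_sub_smul : ∀ i (n : ℤ) x y, w i y = n → n ≤ w i x →
    ∃ r : R, (n + 1 : ℤ) ≤ w i (x - r • y)
  exists_eq : ∀ α : ι → WithTop ℤ, ∃ x, ∀ i, w i x = α i

theorem IsCompleteAdmissible.isValuationFamily {R : Type*} [CommRing R] [IsLocalRing R]
    (hR : IsCompleteAdmissible R) {ι : Type*} (p : ι ≃ minimalPrimes R) :
    IsValuationFamily R fun i (h : FractionRing R) => branchVal (p i) (projBranch (p i) h) where
  le_add i n x y hx hy := by
    rw [map_add]
    exact le_branchVal_add _ _ _ _ hx hy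
  le_smul i n r x hx := by
    rw [projBranch_smul, Algebra.smul_def]
    exact le_branchVal_mul _ _ _ _ hx
  le_smul_of_mem i n r x hr hx := by
    have := hR.isDiscreteValuationRing_branchNormalization (p i)
    rw [projBranch_smul, Algebra.smul_def, branchVal_mul, add_comm, WithTop.coe_add]
    exact add_le_add (one_le_branchVal_algebraMap hr) hx
  exists_le_sub_smul i n x y hy hx := by
    obtain ⟨r, hr⟩ := hR.exists_le_branchVal_sub_smul hy hx
    exact ⟨r, by rwa [map_sub, projBranch_smul]⟩
  exists_eq α := by
    have := hR.isReduced
    have := hR.finite_minimalPrimes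
    have := hR.isDiscreteValuationRing_branchNormalization
    choose x hx using fun P => branchVal_surjective (P := P) (α (p.symm P))
    obtain ⟨h, hh⟩ := exists_forall_projBranch_eq x
    exact ⟨h, fun i => by rw [hh, hx, p.symm_apply_apply]⟩

section ValueSets

variable {R ι : Type*} [CommRing R]

theorem projPartialBranch_projPartial (p : ι → minimalPrimes R) (J : Finset ι) (j : J)
    (h : FractionRing R) : projPartialBranch p J j (projPartial p J h) = projBranch (p j) h := by
  have : (projPartialBranch p J j).comp (projPartial p J) = projBranch (p j) :=
    IsLocalization.ringHom_ext R⁰ <| RingHom.ext fun r => by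
      simp [projPartialBranch, projPartial, projBranch, IsLocalization.map_eq]
  exact DFunLike.congr_fun this h

theorem eq_zero_of_forall_projPartialBranch_eq_zero (p : ι → minimalPrimes R) (J : Finset ι)
    {g : PartialFractions p J} (hg : ∀ j, projPartialBranch p J j g = 0) : g = 0 := by
  obtain ⟨a, s, rfl⟩ := IsLocalization.exists_mk'_eq (PartialRing p J)⁰ g
  obtain ⟨a, rfl⟩ := Ideal.Quotient.mk_surjective a
  suffices Ideal.Quotient.mk (interIdeal p J) a = 0 by rw [this, IsLocalization.mk'_zero]
  rw [Ideal.Quotient.eq_zero_iff_mem, interIdeal, Ideal.mem_iInf]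
  refine fun j => Ideal.mem_iInf.2 fun hj => ?_
  have ha : projPartialBranch p J ⟨j, hj⟩
      (algebraMap _ _ (Ideal.Quotient.mk (interIdeal p J) a)) = 0 := by
    rw [← IsLocalization.mk'_spec (PartialFractions p J) _ s, map_mul, hg, zero_mul]
  rw [projPartialBranch, IsLocalization.map_eq,
    map_eq_zero_iff _ (IsFractionRing.injective _ _), Ideal.Quotient.factor_mk] at ha
  exact Ideal.Quotient.eq_zero_iff_mem.1 ha

theorem ne_zero_of_branchVal_eq_coe {P : minimalPrimes R} {x : BranchField P} {n : ℤ}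
    (hx : branchVal P x = n) : x ≠ 0 := by
  rintro rfl
  exact WithTop.top_ne_coe ((branchVal_zero P).symm.trans hx)

theorem mem_partialValueSet_iff (p : ι → minimalPrimes R)
    (𝓘 : FractionalIdeal R⁰ (FractionRing R)) (J : Finset ι) (β : J → ℤ) :
    β ∈ partialValueSet p 𝓘 J ↔ ∃ h ∈ 𝓘, ∀ j : J, branchVal (p j) (projBranch (p j) h) = β j := by
  constructor
  · rintro ⟨_, ⟨h, hh, rfl⟩, -, hval⟩
    exact ⟨h, hh, fun j => by rw [← hval j, projPartialBranch_projPartial]⟩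
  · rintro ⟨h, hh, hval⟩
    refine ⟨projPartial p J h, ⟨h, hh, rfl⟩, mem_nonZeroDivisors_of_forall_map_ne_zero
      (projPartialBranch p J) (fun _ => eq_zero_of_forall_projPartialBranch_eq_zero p J)
      fun j => ?_, fun j => by rw [projPartialBranch_projPartial, hval]⟩
    rw [projPartialBranch_projPartial]
    exact ne_zero_of_branchVal_eq_coe (hval j)

theorem mem_valueSet_iff [IsReduced R] (p : ι ≃ minimalPrimes R)
    (𝓘 : FractionalIdeal R⁰ (FractionRing R)) (α : ι → ℤ) :
    α ∈ valueSet p 𝓘 ↔ ∃ h ∈ 𝓘, ∀ i, branchVal (p i) (projBranch (p i) h) = α i := by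
  refine exists_congr fun h => and_congr_right fun _ => and_iff_right_of_imp fun hval => ?_
  refine mem_nonZeroDivisors_of_forall_map_ne_zero projBranch
    (fun _ => eq_zero_of_forall_projBranch_eq_zero) fun P => ?_
  obtain ⟨i, rfl⟩ := p.surjective P
  exact ne_zero_of_branchVal_eq_coe (hval i)

end ValueSets

section Bounds

variable {R : Type*} [CommRing R]

theorem exists_forall_branchVal_algebraMap_le [Finite (minimalPrimes R)]
    (hDVR : ∀ P : minimalPrimes R, IsDiscreteValuationRing (BranchNormalization P)) {d : R}
    (hd : d ∈ R⁰) : ∃ N : ℤ, ∀ P : minimalPrimes R,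
      branchVal P (projBranch P (algebraMap R (FractionRing R) d)) ≤ N := by
  choose m hm using fun P : minimalPrimes R => WithTop.ne_top_iff_exists.1
    (branchVal_eq_top_iff.not.2 (projBranch_algebraMap_ne_zero P hd))
  obtain ⟨N, hN⟩ := (Set.finite_range m).bddAbove
  exact ⟨N, fun P => by rw [← hm P]; exact WithTop.coe_le_coe.2 (hN ⟨P, rfl⟩)⟩

namespace IsCompleteAdmissible

variable [IsLocalRing R]

theorem finite_integralClosure (hR : IsCompleteAdmissible R) :
    Module.Finite R (integralClosure R (FractionRing R)) := by
  have := hR.isReduced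
  have := hR.noetherian
  have := hR.finite_minimalPrimes
  have (P : minimalPrimes R) : Module.Finite R (BranchNormalization P) :=
    have := hR.finite_branchNormalization P
    Module.Finite.trans (Branch P) _
  refine Module.Finite.of_injective
    (LinearMap.pi fun P : minimalPrimes R => (projNormalization P).toLinearMap) ?_
  rw [← LinearMap.ker_eq_bot, LinearMap.ker_eq_bot']
  intro h hh
  exact Subtype.ext (eq_zero_of_forall_projBranch_eq_zero fun P =>
    congrArg Subtype.val (congrFun hh P))

theorem exists_forall_le_branchVal_imp_mem (hR : IsCompleteAdmissible R)
    {𝓘 : FractionalIdeal R⁰ (FractionRing R)}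
    (h𝓘 : ∃ d ∈ R⁰, algebraMap R (FractionRing R) d ∈ 𝓘) :
    ∃ N : ℤ, ∀ h : FractionRing R,
      (∀ P : minimalPrimes R, N ≤ branchVal P (projBranch P h)) → h ∈ 𝓘 := by
  have := hR.isReduced
  have := hR.finite_minimalPrimes
  have hDVR := hR.isDiscreteValuationRing_branchNormalization
  obtain ⟨d, hd, hd𝓘⟩ := h𝓘
  obtain ⟨s, hs, hsR⟩ := FractionalIdeal.isFractional_of_fg (S := R⁰)
    (I := Subalgebra.toSubmodule (integralClosure R (FractionRing R)))
    (Module.Finite.iff_fg.1 hR.finite_integralClosure)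
  obtain ⟨N, hN⟩ := exists_forall_branchVal_algebraMap_le hDVR (mul_mem hd hs)
  refine ⟨N, fun h hh => ?_⟩
  obtain ⟨u, hu⟩ := IsLocalization.map_units (FractionRing R) (⟨d * s, mul_mem hd hs⟩ : R⁰)
  obtain ⟨h, rfl⟩ : ∃ h', h = (d * s) • h' :=
    ⟨↑u⁻¹ * h, by rw [Algebra.smul_def, ← hu, Units.mul_inv_cancel_left]⟩
  have h_integral : IsIntegral R h := isIntegral_iff_forall_projBranch_mem.2 fun P => by
    refine zero_le_branchVal_iff.1 (WithTop.le_of_add_le_add_left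
      (ne_top_of_le_ne_top WithTop.coe_ne_top (hN P)) ?_)
    rw [add_zero, ← branchVal_mul, ← map_mul, ← Algebra.smul_def]
    exact (hN P).trans (hh P)
  obtain ⟨r, hr⟩ := hsR h h_integral
  rw [mul_smul, ← hr, algebra_compatible_smul (FractionRing R), smul_eq_mul, mul_comm,
    ← Algebra.smul_def]
  exact (𝓘 : Submodule R (FractionRing R)).smul_mem r hd𝓘

theorem exists_forall_mem_le_branchVal (hR : IsCompleteAdmissible R)
    (𝓘 : FractionalIdeal R⁰ (FractionRing R)) :
    ∃ B : ℤ, ∀ h ∈ 𝓘, ∀ P : minimalPrimes R, B ≤ branchVal P (projBranch P h) := by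
  have := hR.finite_minimalPrimes
  have hDVR := hR.isDiscreteValuationRing_branchNormalization
  obtain ⟨d, hd, hdR⟩ := 𝓘.2
  obtain ⟨N, hN⟩ := exists_forall_branchVal_algebraMap_le hDVR hd
  refine ⟨-N, fun h hh P => ?_⟩
  obtain ⟨r, hr⟩ := hdR h hh
  have h0 : 0 ≤ branchVal P (projBranch P (d • h)) := by
    rw [← hr, projBranch_algebraMap, zero_le_branchVal_iff]
    exact algebraMap_mem ((BranchNormalization P).restrictScalars R) r
  rw [Algebra.smul_def, map_mul, branchVal_mul] at h0
  refine WithTop.le_of_add_le_add_left (WithTop.coe_ne_top (a := N)) ?_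
  calc ((N : ℤ) : WithTop ℤ) + (-N : ℤ) = 0 := by rw [← WithTop.coe_add, add_neg_cancel]; rfl
    _ ≤ _ := h0
    _ ≤ _ := by gcongr; exact hN P

end IsCompleteAdmissible

end Bounds

section ValueSemigroupIdeals

variable {ι : Type*}

/-- The combinatorial properties of the value set of a regular fractional ideal, that is, the
axioms of a good semigroup ideal. -/
structure IsGoodSet (E : Set (ι → ℤ)) : Prop where
  infClosed : InfClosed E
  exchange : ∀ α ∈ E, ∀ β ∈ E, ∀ i, α i = β i → ∃ ε ∈ E, α i < ε i ∧
    ∀ j, min (α j) (β j) ≤ ε j ∧ (α j ≠ β j → ε j = min (α j) (β j))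
  exists_Ici_subset : ∃ δ, Set.Ici δ ⊆ E
  bddBelow : BddBelow E

/-- The values at `k` of the points of `E` whose coordinates in `J` are at least those of `γ`. -/
def valuesAbove (E : Set (ι → ℤ)) (γ : ι → ℤ) (J : Finset ι) (k : ι) : Set ℤ :=
  {n | ∃ β ∈ E, β k = n ∧ ∀ j ∈ J, γ j ≤ β j}

/-- The value set of `I` for the family `w`: only the elements of `I` all of whose values are
finite contribute to it. -/
def finiteValues {K : Type*} (w : ι → K → WithTop ℤ) (I : Set K) : Set (ι → ℤ) :=
  {α | ∃ h ∈ I, ∀ i, w i h = α i}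

end ValueSemigroupIdeals

theorem withTop_eq_intCast_iff {a : WithTop ℤ} {n : ℤ} :
    a = n ↔ (n : WithTop ℤ) ≤ a ∧ ¬ ((n + 1 : ℤ) : WithTop ℤ) ≤ a := by
  cases a with
  | top => simp
  | coe a =>
    rw [WithTop.coe_eq_coe, WithTop.coe_le_coe, WithTop.coe_le_coe]
    omega

theorem length_quotient_eq_add_one_of_covBy {R M : Type*} [CommRing R] [AddCommGroup M]
    [Module R M] {N N' : Submodule R M} (h : N' ⋖ N) :
    Module.length R (M ⧸ N') = Module.length R (M ⧸ N) + 1 := by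
  have hsimple : IsSimpleModule R (N ⧸ N'.comap N.subtype) := (covBy_iff_quot_is_simple h.le).1 h
  have hker : LinearMap.ker ((N'.comap N.subtype).mapQ N' N.subtype le_rfl) = ⊥ := by
    rw [Submodule.ker_mapQ, Submodule.mkQ_map_self]
  have hexact : Function.Exact ((N'.comap N.subtype).mapQ N' N.subtype le_rfl)
      (Submodule.factor h.le) := by
    rw [LinearMap.exact_iff, Submodule.range_mapQ, Submodule.range_subtype]
    exact Submodule.ker_mapQ ..
  rw [Module.length_eq_add_of_exact _ _ (LinearMap.ker_eq_bot.1 hker)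
    (Submodule.factor_surjective h.le) hexact, Module.length_eq_one, add_comm]

theorem covBy_of_forall_exists_sub_smul_mem {R M : Type*} [Ring R] [AddCommGroup M] [Module R M]
    {N N' : Submodule R M} (hlt : N' < N)
    (h : ∀ x ∈ N, ∀ y ∈ N, y ∉ N' → ∃ r : R, x - r • y ∈ N') : N' ⋖ N := by
  refine ⟨hlt, fun L hL' hL => hL.not_ge fun x hx => ?_⟩
  obtain ⟨y, hyL, hy⟩ := SetLike.exists_of_lt hL'
  obtain ⟨r, hr⟩ := h x hx y (hL.le hyL) hy
  exact (L.sub_mem_iff_left (L.smul_mem r hyL)).1 (hL'.le hr)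

namespace IsValuationFamily

variable {R K ι : Type*} [CommRing R] [IsLocalRing R] [AddCommGroup K] [Module R K]
  {w : ι → K → WithTop ℤ}

section Values

variable {i : ι} {m n : ℤ} {x y : K}

theorem le_sub (hw : IsValuationFamily R w) (hx : (n : WithTop ℤ) ≤ w i x)
    (hy : (n : WithTop ℤ) ≤ w i y) : (n : WithTop ℤ) ≤ w i (x - y) := by
  rw [sub_eq_add_neg, ← neg_one_smul R y]
  exact hw.le_add i n _ _ hx (hw.le_smul i n _ _ hy)

theorem le_smul_iff (hw : IsValuationFamily R w) {r : R} (hr : IsUnit r) :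
    (n : WithTop ℤ) ≤ w i (r • x) ↔ (n : WithTop ℤ) ≤ w i x := by
  refine ⟨fun h => ?_, hw.le_smul i n r x⟩
  obtain ⟨u, rfl⟩ := hr
  have := hw.le_smul i n (↑u⁻¹ : R) _ h
  rwa [smul_smul, Units.inv_mul, one_smul] at this

theorem smul_eq_iff (hw : IsValuationFamily R w) {r : R} (hr : IsUnit r) :
    w i (r • x) = n ↔ w i x = n := by
  rw [withTop_eq_intCast_iff, withTop_eq_intCast_iff, hw.le_smul_iff hr, hw.le_smul_iff hr]

theorem add_eq_left (hw : IsValuationFamily R w) (hx : w i x = n)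
    (hy : ((n + 1 : ℤ) : WithTop ℤ) ≤ w i y) : w i (x + y) = n := by
  rw [withTop_eq_intCast_iff] at hx ⊢
  refine ⟨hw.le_add i n _ _ hx.1 (le_trans (WithTop.coe_le_coe.2 (by omega)) hy), fun h => hx.2 ?_⟩
  have := hw.le_sub h hy
  rwa [add_sub_cancel_right] at this

theorem sub_eq_min (hw : IsValuationFamily R w) (hx : w i x = m) (hy : w i y = n) (hmn : m ≠ n) :
    w i (x - y) = (min m n : ℤ) := by
  have hy' : w i ((-1 : R) • y) = n := (hw.smul_eq_iff isUnit_one.neg).2 hy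
  rw [sub_eq_add_neg, ← neg_one_smul R y]
  rcases hmn.lt_or_gt with h | h
  · rw [min_eq_left h.le]
    exact hw.add_eq_left hx (hy'.symm ▸ WithTop.coe_le_coe.2 h)
  · rw [min_eq_right h.le, add_comm]
    exact hw.add_eq_left hy' (hx.symm ▸ WithTop.coe_le_coe.2 h)

theorem le_and_le_of_le_add_smul (hw : IsValuationFamily R w) {r r' : R} (hr : IsUnit (r - r'))
    (h : (n : WithTop ℤ) ≤ w i (x + r • y)) (h' : (n : WithTop ℤ) ≤ w i (x + r' • y)) :
    (n : WithTop ℤ) ≤ w i x ∧ (n : WithTop ℤ) ≤ w i y := by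
  have hy : (n : WithTop ℤ) ≤ w i y := by
    rw [← hw.le_smul_iff hr, sub_smul, ← add_sub_add_left_eq_sub _ _ x]
    exact hw.le_sub h h'
  refine ⟨?_, hy⟩
  rw [← add_sub_cancel_right x (r • y)]
  exact hw.le_sub h (hw.le_smul i n r y hy)

theorem exists_isUnit_le_sub_smul (hw : IsValuationFamily R w) (hx : w i x = n) (hy : w i y = n) :
    ∃ r : R, IsUnit r ∧ ((n + 1 : ℤ) : WithTop ℤ) ≤ w i (x - r • y) := by
  obtain ⟨r, hr⟩ := hw.exists_le_sub_smul i n x y hy hx.ge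
  refine ⟨r, ?_, hr⟩
  by_contra hu
  have hry := hw.le_smul_of_mem i n r y ((mem_maximalIdeal r).2 hu) hy.ge
  have hx' := hw.le_add _ _ _ _ hr hry
  rw [sub_add_cancel] at hx'
  exact (withTop_eq_intCast_iff.1 hx).2 hx'

end Values

/-- The submodule of the elements with values at least `γ`. -/
def superlevel (hw : IsValuationFamily R w) (γ : ι → ℤ) : Submodule R K where
  carrier := {h | ∀ i, γ i ≤ w i h}
  zero_mem' i := by
    obtain ⟨x, hx⟩ := hw.exists_eq fun _ => ⊤
    rw [← zero_smul R x]
    exact hw.le_smul i _ _ _ (hx i ▸ le_top)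
  add_mem' hx hy i := hw.le_add i _ _ _ (hx i) (hy i)
  smul_mem' r _ hx i := hw.le_smul i _ r _ (hx i)

variable {I : Submodule R K}

theorem exists_mem_finiteValues (hw : IsValuationFamily R w)
    (hI : ∃ δ, hw.superlevel δ ≤ I) {h : K} (hh : h ∈ I) (γ : ι → ℤ) :
    ∃ α ∈ finiteValues w I, ∀ i, w i h = α i ∨ w i h = ⊤ ∧ γ i ≤ α i := by
  classical
  obtain ⟨δ, hδ⟩ := hI
  obtain ⟨t, ht⟩ := hw.exists_eq fun i => if w i h = ⊤ then ((δ ⊔ γ) i : WithTop ℤ) else ⊤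
  have htI : t ∈ I := hδ fun i => by
    rw [ht]
    split_ifs
    exacts [WithTop.coe_le_coe.2 le_sup_left, le_top]
  have hsum (i : ι) : ∃ n : ℤ, w i (h + t) = n ∧ (w i h = n ∨ w i h = ⊤ ∧ γ i ≤ n) := by
    specialize ht i
    cases hi : w i h with
    | top =>
      rw [if_pos hi] at ht
      exact ⟨(δ ⊔ γ) i, add_comm h t ▸ hw.add_eq_left ht (hi.symm ▸ le_top),
        .inr ⟨rfl, le_sup_right⟩⟩
    | coe n =>
      rw [if_neg (hi.symm ▸ WithTop.coe_ne_top)] at ht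
      exact ⟨n, hw.add_eq_left hi (ht.symm ▸ le_top), .inl rfl⟩
  choose α hα hα' using hsum
  exact ⟨α, ⟨h + t, I.add_mem hh htI, hα⟩, hα'⟩

-- In each coordinate `i`, at most one residue class of `c` makes the value of `f + c • g` exceed
-- the minimum of `α i` and `β i`, and none does if `α i < β i`. So some class works everywhere.
theorem infClosed_finiteValues (hw : IsValuationFamily R w) [Finite ι]
    (hk : ENat.card ι ≤ ENat.card (ResidueField R)) : InfClosed (finiteValues w (I : Set K)) := by
  intro α hα β hβ
  by_cases hle : β ≤ α
  · rwa [inf_eq_right.2 hle]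
  obtain ⟨i₀, hi₀⟩ : ∃ i, α i < β i := by simpa [Pi.le_def] using hle
  obtain ⟨f, hf, hfα⟩ := hα
  obtain ⟨g, hg, hgβ⟩ := hβ
  choose r hr using residue_surjective (R := R)
  by_contra! hcon
  have hbad (c : ResidueField R) : ∃ j, (((α ⊓ β) j + 1 : ℤ) : WithTop ℤ) ≤ w j (f + r c • g) := by
    by_contra! hc
    refine hcon ⟨f + r c • g, I.add_mem hf (I.smul_mem _ hg), fun j =>
      withTop_eq_intCast_iff.2 ⟨hw.le_add _ _ _ _ ?_ (hw.le_smul _ _ _ _ ?_), (hc j).not_ge⟩⟩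
    · exact hfα j ▸ WithTop.coe_le_coe.2 inf_le_left
    · exact hgβ j ▸ WithTop.coe_le_coe.2 inf_le_right
  choose φ hφ using hbad
  have hinj : Function.Injective φ := by
    intro c c' hcc
    by_contra hne
    have hu : IsUnit (r c - r c') := by
      rw [← residue_ne_zero_iff_isUnit, map_sub, hr, hr]
      exact sub_ne_zero.2 hne
    obtain ⟨hf', hg'⟩ := hw.le_and_le_of_le_add_smul hu (hφ c) (hcc ▸ hφ c')
    rw [hfα, WithTop.coe_le_coe, Pi.inf_apply] at hf'
    rw [hgβ, WithTop.coe_le_coe, Pi.inf_apply] at hg'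
    omega
  have : Finite (ResidueField R) := Finite.of_injective φ hinj
  rw [ENat.card_eq_coe_natCard, ENat.card_eq_coe_natCard, Nat.cast_le] at hk
  obtain ⟨c, rfl⟩ := (hinj.bijective_of_nat_card_le hk).2 i₀
  have hc := hφ c
  rw [hw.add_eq_left (hfα _) (hw.le_smul _ _ _ _ (hgβ (φ c) ▸ WithTop.coe_le_coe.2 hi₀)),
    WithTop.coe_le_coe, Pi.inf_apply, min_eq_left hi₀.le] at hc
  omega

theorem exchange_finiteValues (hw : IsValuationFamily R w) (hI : ∃ δ, hw.superlevel δ ≤ I)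
    {α β : ι → ℤ} (hα : α ∈ finiteValues w I) (hβ : β ∈ finiteValues w I) {i : ι}
    (hi : α i = β i) : ∃ ε ∈ finiteValues w I, α i < ε i ∧
      ∀ j, min (α j) (β j) ≤ ε j ∧ (α j ≠ β j → ε j = min (α j) (β j)) := by
  obtain ⟨f, hf, hfα⟩ := hα
  obtain ⟨g, hg, hgβ⟩ := hβ
  obtain ⟨r, hu, hr⟩ := hw.exists_isUnit_le_sub_smul (hfα i) (hi ▸ hgβ i)
  have hrg (j : ι) : w j (r • g) = β j := (hw.smul_eq_iff hu).2 (hgβ j)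
  obtain ⟨ε, hε, hε'⟩ := hw.exists_mem_finiteValues hI (I.sub_mem hf (I.smul_mem r hg)) (α + 1)
  refine ⟨ε, hε, ?_, fun j => ⟨?_, fun hne => ?_⟩⟩
  · rcases hε' i with h | ⟨-, h⟩
    · rwa [h, WithTop.coe_le_coe] at hr
    · exact h
  · rcases hε' j with h | ⟨-, h⟩
    · rw [← WithTop.coe_le_coe, ← h]
      exact hw.le_sub (hfα j ▸ WithTop.coe_le_coe.2 (min_le_left _ _))
        (hrg j ▸ WithTop.coe_le_coe.2 (min_le_right _ _))
    · exact (min_le_left _ _).trans ((Int.le_add_one le_rfl).trans h)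
  · have hmin := hw.sub_eq_min (hfα j) (hrg j) hne
    rcases hε' j with h | ⟨h, -⟩
    · exact WithTop.coe_inj.1 (h.symm.trans hmin)
    · exact absurd (hmin.symm.trans h) WithTop.coe_ne_top

theorem isGoodSet_finiteValues (hw : IsValuationFamily R w) [Finite ι]
    (hk : ENat.card ι ≤ ENat.card (ResidueField R)) (hI : ∃ δ, hw.superlevel δ ≤ I)
    (hI' : ∃ δ, I ≤ hw.superlevel δ) : IsGoodSet (finiteValues w (I : Set K)) where
  infClosed := hw.infClosed_finiteValues hk
  exchange _ hα _ hβ _ hi := hw.exchange_finiteValues hI hα hβ hi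
  exists_Ici_subset := by
    obtain ⟨δ, hδ⟩ := hI
    refine ⟨δ, fun α hα => ?_⟩
    obtain ⟨h, hh⟩ := hw.exists_eq fun i => (α i : WithTop ℤ)
    exact ⟨h, hδ fun i => hh i ▸ WithTop.coe_le_coe.2 (hα i), hh⟩
  bddBelow := by
    obtain ⟨δ, hδ⟩ := hI'
    exact ⟨δ, fun α ⟨h, hh, hα⟩ i => WithTop.coe_le_coe.1 (hα i ▸ hδ hh i)⟩

theorem le_superlevel (hw : IsValuationFamily R w) (hI : ∃ δ, hw.superlevel δ ≤ I) {γ : ι → ℤ}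
    (hγ : γ ∈ lowerBounds (finiteValues w (I : Set K))) : I ≤ hw.superlevel γ := by
  intro h hh i
  obtain ⟨α, hα, hα'⟩ := hw.exists_mem_finiteValues hI hh γ
  rcases hα' i with h | ⟨h, -⟩
  · exact h ▸ WithTop.coe_le_coe.2 (hγ hα i)
  · exact h ▸ le_top

section Length

variable [DecidableEq ι] {γ : ι → ℤ} {i : ι}

theorem mem_superlevel_update_iff (hw : IsValuationFamily R w) {h : K} (hh : h ∈ hw.superlevel γ) :
    h ∈ hw.superlevel (Function.update γ i (γ i + 1)) ↔ ((γ i + 1 : ℤ) : WithTop ℤ) ≤ w i h := by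
  refine ⟨fun h' => by simpa using h' i, fun h' j => ?_⟩
  rcases eq_or_ne j i with rfl | hj
  · rwa [Function.update_self]
  · rw [Function.update_of_ne hj]
    exact hh j

theorem superlevel_update_le (hw : IsValuationFamily R w) :
    hw.superlevel (Function.update γ i (γ i + 1)) ≤ hw.superlevel γ := fun _ hh j =>
  (WithTop.coe_le_coe.2 (le_update_self_iff.2 (Int.le_add_one le_rfl) j)).trans (hh j)

variable [Fintype ι]

theorem superlevel_submoduleOf_covBy (hw : IsValuationFamily R w)
    (hγ : γ i ∈ valuesAbove (finiteValues w (I : Set K)) γ {i}ᶜ i) :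
    (hw.superlevel (Function.update γ i (γ i + 1))).submoduleOf I ⋖
      (hw.superlevel γ).submoduleOf I := by
  obtain ⟨β, ⟨g, hg, hgβ⟩, hβi, hβ⟩ := hγ
  have hgγ : g ∈ hw.superlevel γ := fun j => by
    rw [hgβ, WithTop.coe_le_coe]
    rcases eq_or_ne j i with rfl | hj
    exacts [hβi.ge, hβ j (by simpa using hj)]
  refine covBy_of_forall_exists_sub_smul_mem (SetLike.lt_iff_le_and_exists.2
    ⟨Submodule.comap_mono hw.superlevel_update_le, ⟨g, hg⟩, hgγ, fun h => ?_⟩)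
    fun x hx y hy hy' => ?_
  · have h := (hw.mem_superlevel_update_iff hgγ).1 h
    rw [hgβ, hβi, WithTop.coe_le_coe] at h
    omega
  · have hy' : w i y = γ i := withTop_eq_intCast_iff.2
      ⟨hy i, fun h => hy' ((hw.mem_superlevel_update_iff hy).2 h)⟩
    obtain ⟨r, hr⟩ := hw.exists_le_sub_smul i (γ i) x y hy' (hx i)
    exact ⟨r, (hw.mem_superlevel_update_iff
      (Submodule.sub_mem _ hx (Submodule.smul_mem _ r hy))).2 hr⟩

theorem superlevel_submoduleOf_eq (hw : IsValuationFamily R w) (hI : ∃ δ, hw.superlevel δ ≤ I)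
    (hγ : γ i ∉ valuesAbove (finiteValues w (I : Set K)) γ {i}ᶜ i) :
    (hw.superlevel (Function.update γ i (γ i + 1))).submoduleOf I =
      (hw.superlevel γ).submoduleOf I := by
  refine (Submodule.comap_mono hw.superlevel_update_le).antisymm fun h hh => ?_
  refine (hw.mem_superlevel_update_iff hh).2 (by_contra fun hlt => hγ ?_)
  have hi := withTop_eq_intCast_iff.2 ⟨hh i, hlt⟩
  obtain ⟨β, hβ, hβ'⟩ := hw.exists_mem_finiteValues hI h.2 γ
  refine ⟨β, hβ, ?_, fun j _ => ?_⟩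
  · rcases hβ' i with h' | ⟨h', -⟩
    · exact WithTop.coe_inj.1 (h'.symm.trans hi)
    · exact absurd (hi.symm.trans h') WithTop.coe_ne_top
  · rcases hβ' j with h' | ⟨-, h'⟩
    · exact WithTop.coe_le_coe.1 (h' ▸ hh j)
    · exact h'

theorem length_quotient_superlevel_update (hw : IsValuationFamily R w)
    (hI : ∃ δ, hw.superlevel δ ≤ I) (γ : ι → ℤ) (i : ι) :
    Module.length R (I ⧸ (hw.superlevel (Function.update γ i (γ i + 1))).submoduleOf I) =
      Module.length R (I ⧸ (hw.superlevel γ).submoduleOf I) +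
        ({γ i} ∩ valuesAbove (finiteValues w (I : Set K)) γ {i}ᶜ i).encard := by
  by_cases hγ : γ i ∈ valuesAbove (finiteValues w (I : Set K)) γ {i}ᶜ i
  · rw [Set.inter_eq_left.2 (Set.singleton_subset_iff.2 hγ), Set.encard_singleton]
    exact length_quotient_eq_add_one_of_covBy (hw.superlevel_submoduleOf_covBy hγ)
  · rw [Set.singleton_inter_eq_empty.2 hγ, Set.encard_empty, add_zero,
      hw.superlevel_submoduleOf_eq hI hγ]

end Length

end IsValuationFamily

theorem exists_isLeast_of_infClosed {ι : Type*} [Finite ι] {S : Set (ι → ℤ)} (hne : S.Nonempty)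
    (hbdd : BddBelow S) (hS : InfClosed S) : ∃ α, IsLeast S α := by
  classical
  have := Fintype.ofFinite ι
  obtain ⟨σ, hσ⟩ := hne
  obtain ⟨l, hl⟩ := hbdd
  obtain ⟨α, hα⟩ := ((Set.finite_Icc l σ).inter_of_right S).exists_minimal ⟨σ, hσ, hl hσ, le_rfl⟩
  refine ⟨α, hα.prop.1, fun β hβ => ?_⟩
  have hαβ := hS hα.prop.1 hβ
  exact inf_eq_left.1 (hα.eq_of_le ⟨hαβ, hl hαβ, inf_le_left.trans hα.prop.2.2⟩ inf_le_left)

theorem Ici_restrict_subset_image_restrict {ι : Type*} {E : Set (ι → ℤ)} {γ : ι → ℤ} (s : Finset ι)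
    (hγ : Set.Ici γ ⊆ E) : Set.Ici (s.restrict γ) ⊆ s.restrict '' E := by
  classical
  intro β hβ
  refine ⟨fun k => if hk : k ∈ s then β ⟨k, hk⟩ else γ k, hγ fun k => ?_,
    funext fun k => dif_pos k.2⟩
  dsimp only
  split_ifs with hk
  exacts [hβ ⟨k, hk⟩, le_rfl]

namespace IsGoodSet

variable {ι : Type*} {E : Set (ι → ℤ)} {α β γ : ι → ℤ} {i j k : ι} {J : Finset ι}

theorem exists_isLeast (hE : IsGoodSet E) [Finite ι] : ∃ α, IsLeast E α :=
  exists_isLeast_of_infClosed (Set.nonempty_Ici.mono hE.exists_Ici_subset.choose_spec) hE.bddBelow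
    hE.infClosed

theorem exists_isConductor (hE : IsGoodSet E) [Finite ι] : ∃ c, IsConductor E c := by
  refine exists_isLeast_of_infClosed hE.exists_Ici_subset
    (hE.bddBelow.mono fun δ hδ => hδ Set.self_mem_Ici) fun δ hδ δ' hδ' β hβ => ?_
  rw [← sup_eq_left.2 (Set.mem_Ici.1 hβ), sup_inf_left]
  exact hE.infClosed (hδ (Set.mem_Ici.2 le_sup_right)) (hδ' (Set.mem_Ici.2 le_sup_right))

theorem exists_add_le_and_forall_ne_eq (hE : IsGoodSet E) (hγ : Set.Ici γ ⊆ E) (hα : α ∈ E)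
    (hi : γ i ≤ α i) (n : ℕ) : ∃ ε ∈ E, α i + n ≤ ε i ∧ ∀ j ≠ i, ε j = α j := by
  classical
  induction n with
  | zero => exact ⟨α, hα, by simp, fun _ _ => rfl⟩
  | succ n ih =>
    obtain ⟨ε, hε, hεi, hεj⟩ := ih
    have hmem : Function.update (ε ⊔ γ + 1) i (ε i) ∈ E := hγ <| Set.mem_Ici.2 <|
      le_update_iff.2 ⟨by omega, fun j _ => le_sup_right.trans (Int.le_add_one le_rfl)⟩
    obtain ⟨ε', hε', hi', hj'⟩ := hE.exchange ε hε _ hmem i (by simp)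
    refine ⟨ε', hε', by push_cast; omega, fun j hj => ?_⟩
    have hlt : ε j < Function.update (ε ⊔ γ + 1) i (ε i) j := by
      rw [Function.update_of_ne hj]
      exact Int.lt_add_one_of_le le_sup_left
    rw [(hj' j).2 hlt.ne, min_eq_left hlt.le, hεj j hj]

theorem update_mem (hE : IsGoodSet E) [DecidableEq ι] (hγ : Set.Ici γ ⊆ E) (hα : α ∈ E)
    (hi : γ i ≤ α i) {m : ℤ} (hm : γ i ≤ m) : Function.update α i m ∈ E := by
  obtain ⟨ε, hε, hεi, hεj⟩ := hE.exists_add_le_and_forall_ne_eq hγ hα hi (m - α i).toNat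
  have hmem : Function.update (α ⊔ γ) i m ∈ E :=
    hγ (Set.mem_Ici.2 (le_update_iff.2 ⟨hm, fun j _ => le_sup_right⟩))
  convert hE.infClosed hε hmem using 1
  ext j
  rcases eq_or_ne j i with rfl | hj
  · simp only [Function.update_self, Pi.inf_apply]
    omega
  · simp only [Function.update_of_ne hj, Pi.inf_apply, Pi.sup_apply, hεj j hj]
    omega

theorem restrict (hE : IsGoodSet E) (s : Finset ι) : IsGoodSet (s.restrict '' E) where
  infClosed := by
    rintro _ ⟨α, hα, rfl⟩ _ ⟨β, hβ, rfl⟩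
    exact ⟨α ⊓ β, hE.infClosed hα hβ, rfl⟩
  exchange := by
    rintro _ ⟨α, hα, rfl⟩ _ ⟨β, hβ, rfl⟩ i hi
    obtain ⟨ε, hε, hεi, hεj⟩ := hE.exchange α hα β hβ i hi
    exact ⟨s.restrict ε, ⟨ε, hε, rfl⟩, hεi, fun j => hεj j⟩
  exists_Ici_subset :=
    have ⟨_, hδ⟩ := hE.exists_Ici_subset
    ⟨_, Ici_restrict_subset_image_restrict s hδ⟩
  bddBelow := by
    obtain ⟨l, hl⟩ := hE.bddBelow
    exact ⟨s.restrict l, Set.forall_mem_image.2 fun α hα j => hl hα j⟩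

theorem fiber_union_nonempty (hE : IsGoodSet E) [DecidableEq ι] {J' : Finset ι}
    (hJ : (fiber J E α).Nonempty) (hJ' : (fiber J' E α).Nonempty) :
    (fiber (J ∪ J') E α).Nonempty := by
  obtain ⟨β, hβ, hβJ, hβlt⟩ := hJ
  obtain ⟨δ, hδ, hδJ, hδlt⟩ := hJ'
  refine ⟨β ⊓ δ, hE.infClosed hβ hδ, fun j hj => ?_, fun j hj => ?_⟩ <;> grind [Pi.inf_apply]

theorem mem_absoluteMaximals_iff (hE : IsGoodSet E) [Fintype ι] [Nontrivial ι] (k : ι) :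
    α ∈ absoluteMaximals E ↔ Maximal (fun β => β ∈ E ∧ β k = α k) α := by
  classical
  constructor
  · rintro ⟨⟨hα, -⟩, h⟩
    refine ⟨⟨hα, rfl⟩, fun β ⟨hβ, hβk⟩ hle => ?_⟩
    by_contra hnle
    have hne : ({j | β j = α j} : Finset ι) ≠ Finset.univ := fun huniv => hnle fun j =>
      (Finset.filter_eq_self.1 huniv j (Finset.mem_univ j)).le
    refine Set.notMem_empty β (h {j | β j = α j} ⟨k, by simpa using hβk⟩ hne ▸ ⟨hβ, ?_, ?_⟩)
    · simp
    · exact fun j hj => lt_of_le_of_ne (hle j) fun h => hj (by simpa using h.symm)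
  · intro hα
    suffices h : ∀ J : Finset ι, J.Nonempty → J ≠ Finset.univ → fiber J E α = ∅ from
      ⟨⟨hα.prop.1, fun i => h _ (Finset.singleton_nonempty i) (Finset.singleton_ne_univ i)⟩, h⟩
    rintro J ⟨j, hj⟩ hJ
    refine Set.eq_empty_iff_forall_notMem.2 fun β ⟨hβ, hβJ, hβlt⟩ => ?_
    have hle : α ≤ β := fun i => if hi : i ∈ J then (hβJ i hi).ge else (hβlt i hi).le
    by_cases hk : k ∈ J
    · obtain ⟨i, hi⟩ : ∃ i, i ∉ J := by simpa [Finset.eq_univ_iff_forall] using hJ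
      exact (hβlt i hi).not_ge (hα.le_of_ge ⟨hβ, hβJ k hk⟩ hle i)
    · obtain ⟨ε, hε, hεj, hε'⟩ := hE.exchange α hα.prop.1 β hβ j (hβJ j hj).symm
      have hεk : ε k = α k := by rw [(hε' k).2 (hβlt k hk).ne, min_eq_left (hle k)]
      have hαε : α ≤ ε := fun i => min_eq_left (hle i) ▸ (hε' i).1
      exact hεj.not_ge (hα.le_of_ge ⟨hε, hεk⟩ hαε j)

theorem fiber_singleton_eq_empty (hE : IsGoodSet E) [DecidableEq ι] (hik : i ≠ k)
    (hk : fiber {k} E α = ∅) (h : (fiber {i, k} E α).Nonempty) : fiber {i} E α = ∅ := by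
  obtain ⟨δ, hδ, hδeq, hδlt⟩ := h
  refine Set.eq_empty_iff_forall_notMem.2 fun β ⟨hβ, hβi, hβlt⟩ => ?_
  obtain ⟨ε, hε, hεi, hεj⟩ := hE.exchange β hβ δ hδ i (by grind)
  refine Set.notMem_empty ε (hk ▸ ⟨hε, fun j hj => ?_, fun j hj => ?_⟩) <;> grind [hεj j]

theorem fiber_pair_nonempty (hE : IsGoodSet E) [DecidableEq ι] (hik : i ≠ k) (hjk : j ≠ k)
    (hij : i ≠ j) (hi : (fiber {i, k} E α).Nonempty) (hj : (fiber {j, k} E α).Nonempty) :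
    (fiber {i, j} E α).Nonempty := by
  obtain ⟨β, hβ, hβeq, hβlt⟩ := hi
  obtain ⟨δ, hδ, hδeq, hδlt⟩ := hj
  obtain ⟨ε, hε, hεk, hεj⟩ := hE.exchange β hβ δ hδ k (by grind)
  refine ⟨ε, hε, fun l hl => ?_, fun l hl => ?_⟩ <;> grind [hεj l]

theorem mem_relativeMaximals_iff (hE : IsGoodSet E) [DecidableEq ι] (k : ι) :
    α ∈ relativeMaximals E ↔
      α ∈ E ∧ fiber {k} E α = ∅ ∧ ∀ i ≠ k, (fiber {i, k} E α).Nonempty := by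
  refine ⟨fun ⟨hα, h⟩ => ⟨hα.1, hα.2 k, fun i hi => h _ (Finset.card_pair hi).ge⟩, ?_⟩
  rintro ⟨hα, hk, h⟩
  have hpair {i j : ι} (hij : i ≠ j) : (fiber {i, j} E α).Nonempty := by
    rcases eq_or_ne j k with rfl | hj
    · exact h i hij
    rcases eq_or_ne i k with rfl | hi
    · exact Finset.pair_comm i j ▸ h j hj
    · exact hE.fiber_pair_nonempty hi hj hij (h i hi) (h j hj)
  have hinsert (i : ι) (s : Finset ι) (hs : s.Nonempty) (hi : i ∉ s) :
      (fiber (insert i s) E α).Nonempty := by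
    induction hs using Finset.Nonempty.cons_induction with
    | singleton j => exact hpair (by simpa using hi)
    | cons j s hj _ ih =>
      rw [Finset.mem_cons, not_or] at hi
      convert hE.fiber_union_nonempty (hpair hi.1) (ih hi.2) using 2
      grind
  refine ⟨⟨hα, fun i => ?_⟩, fun J hJ => ?_⟩
  · rcases eq_or_ne i k with rfl | hi
    · exact hk
    · exact hE.fiber_singleton_eq_empty hi hk (h i hi)
  · obtain ⟨i, hi⟩ := Finset.card_pos.1 (zero_lt_two.trans_le hJ)
    rw [← Finset.insert_erase hi]
    refine hinsert i _ (Finset.card_pos.1 ?_) (Finset.notMem_erase i J)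
    rw [Finset.card_erase_of_mem hi]
    omega

end IsGoodSet

section Gaps

variable {A : Set ℤ} {a b : ℤ}

theorem gaps_eq_Ico_sdiff (ha : IsLeast A a) (hb : Set.Ici b ⊆ A) : gaps A = Set.Ico a b \ A := by
  ext n
  refine ⟨fun ⟨hn, m, hm, hmn⟩ => ⟨⟨(ha.2 hm).trans hmn.le, not_le.1 fun h => hn (hb h)⟩, hn⟩,
    fun ⟨hn, hnA⟩ => ⟨hnA, a, ha.1, lt_of_le_of_ne hn.1 fun h => hnA (h ▸ ha.1)⟩⟩

theorem ncard_Ico_inter_add_ncard_sdiff_add_ncard_gaps {V : Set ℤ} (ha : IsLeast A a)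
    (hb : Set.Ici b ⊆ A) (hab : a ≤ b) (hV : V ⊆ A) (hV' : A \ V ⊆ Set.Ico a b) :
    ((Set.Ico a b ∩ V).ncard + (A \ V).ncard + (gaps A).ncard : ℤ) = b - a := by
  have h₁ := Set.ncard_inter_add_ncard_sdiff_eq_ncard (Set.Ico a b) A
  have h₂ := Set.ncard_inter_add_ncard_sdiff_eq_ncard (Set.Ico a b ∩ A) V
    ((Set.finite_Ico a b).inter_of_left A)
  rw [Set.inter_assoc, Set.inter_eq_right.2 hV, Set.inter_sdiff_assoc,
    Set.inter_eq_right.2 hV'] at h₂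
  have h₃ : (Set.Ico a b).ncard = (b - a).toNat := by
    rw [Set.ncard_eq_toFinset_card', Set.toFinset_Ico, Int.card_Ico]
  rw [← gaps_eq_Ico_sdiff ha hb, ← h₂, h₃] at h₁
  omega

end Gaps

section ValuesAbove

variable {ι : Type*} {E : Set (ι → ℤ)} {a γ δ : ι → ℤ} {J : Finset ι} {k : ι}

theorem valuesAbove_subset_image_eval : valuesAbove E γ J k ⊆ Function.eval k '' E :=
  fun _ ⟨β, hβ, hβk, _⟩ => ⟨β, hβ, hβk⟩

theorem valuesAbove_congr (h : ∀ j ∈ J, γ j = δ j) : valuesAbove E γ J k = valuesAbove E δ J k := by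
  grind [valuesAbove]

theorem image_eval_sdiff_valuesAbove_subset_Ico (ha : a ∈ lowerBounds E) (hγ : Set.Ici γ ⊆ E) :
    Function.eval k '' E \ valuesAbove E γ J k ⊆ Set.Ico (a k) (γ k) := by
  classical
  rintro _ ⟨⟨β, hβ, rfl⟩, hn⟩
  refine ⟨ha hβ k, not_le.1 fun h => hn ?_⟩
  have hle : γ ≤ Function.update γ k (β k) := le_update_self_iff.2 h
  exact ⟨_, hγ hle, Function.update_self .., fun j _ => hle j⟩

theorem Ici_subset_image_eval (hγ : Set.Ici γ ⊆ E) : Set.Ici (γ k) ⊆ Function.eval k '' E := by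
  classical
  exact fun n hn => ⟨Function.update γ k n, hγ (Set.mem_Ici.2 (le_update_self_iff.2 hn)),
    Function.update_self ..⟩

theorem isLeast_image_eval (ha : IsLeast E a) : IsLeast (Function.eval k '' E) (a k) :=
  (Function.monotone_eval k).map_isLeast ha

theorem finite_gaps_image_eval (ha : IsLeast E a) (hγ : Set.Ici γ ⊆ E) :
    (gaps (Function.eval k '' E)).Finite := by
  rw [gaps_eq_Ico_sdiff (isLeast_image_eval ha) (Ici_subset_image_eval hγ)]
  exact (Set.finite_Ico _ _).sdiff

theorem ncard_Ico_inter_valuesAbove (ha : IsLeast E a) (hγ : Set.Ici γ ⊆ E) :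
    ((Set.Ico (a k) (γ k) ∩ valuesAbove E γ J k).ncard : ℤ) =
      γ k - a k - (gaps (Function.eval k '' E)).ncard -
        (Function.eval k '' E \ valuesAbove E γ J k).ncard := by
  have := ncard_Ico_inter_add_ncard_sdiff_add_ncard_gaps (isLeast_image_eval (k := k) ha)
    (Ici_subset_image_eval hγ) (ha.2 (hγ Set.self_mem_Ici) k)
    valuesAbove_subset_image_eval (image_eval_sdiff_valuesAbove_subset_Ico (J := J) ha.2 hγ)
  omega

theorem image_eval_sdiff_valuesAbove_empty :
    Function.eval k '' E \ valuesAbove E γ ∅ k = ∅ :=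
  Set.sdiff_eq_empty.2 fun _ ⟨β, hβ, hβk⟩ => ⟨β, hβ, hβk, by simp⟩

end ValuesAbove

section LengthPath

variable {ι : Type*} [Fintype ι] {E : Set (ι → ℤ)} {L : (ι → ℤ) → ℕ∞}

theorem length_update [DecidableEq ι] (hL : ∀ α i, L (Function.update α i (α i + 1)) =
      L α + ({α i} ∩ valuesAbove E α {i}ᶜ i).encard) (α : ι → ℤ) (i : ι) {b : ℤ} (hb : α i ≤ b) :
    L (Function.update α i b) = L α + (Set.Ico (α i) b ∩ valuesAbove E α {i}ᶜ i).encard := by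
  induction b, hb using Int.leInduction with
  | base => simp
  | succ b hb ih =>
    have hstep := hL (Function.update α i b) i
    rw [Function.update_self, Function.update_idem, ih, valuesAbove_congr
      fun j hj => Function.update_of_ne (Finset.notMem_singleton.1 (Finset.mem_compl.1 hj)) b α]
      at hstep
    have hdisj : Disjoint (Set.Ico (α i) b) {b} := by simp
    rw [hstep, add_assoc, ← Set.encard_union_eq (hdisj.mono Set.inter_subset_left
      Set.inter_subset_left), ← Set.union_inter_distrib_right, Set.union_singleton,
      ← Order.succ_eq_add_one b, Order.Ico_succ_right_eq_insert hb]

theorem length_eq_add_sum [LinearOrder ι] (hL : ∀ α i, L (Function.update α i (α i + 1)) =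
      L α + ({α i} ∩ valuesAbove E α {i}ᶜ i).encard) {a γ : ι → ℤ} (ha : a ∈ lowerBounds E)
    (haγ : a ≤ γ) :
    L γ = L a + ∑ k, (Set.Ico (a k) (γ k) ∩ valuesAbove E γ {j | j < k} k).encard := by
  suffices h : ∀ s : Finset ι, L (s.piecewise γ a) =
      L a + ∑ k ∈ s, (Set.Ico (a k) (γ k) ∩ valuesAbove E γ {j ∈ s | j < k} k).encard by
    simpa using h Finset.univ
  intro s
  induction s using Finset.induction_on_max with
  | empty => simp
  | insert k s hk ih =>
    have hks : k ∉ s := fun h => lt_irrefl k (hk k h)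
    have hpk : s.piecewise γ a k = a k := Finset.piecewise_eq_of_notMem _ _ _ hks
    have hvalues : valuesAbove E (s.piecewise γ a) {k}ᶜ k = valuesAbove E γ s k := by
      ext n
      refine exists_congr fun β => and_congr_right fun hβ => and_congr_right fun _ => ?_
      have := ha hβ
      grind [Finset.piecewise, Pi.le_def, Finset.mem_compl]
    have hfilter : {j ∈ insert k s | j < k} = s := by grind
    have hsum : ∑ i ∈ s, (Set.Ico (a i) (γ i) ∩ valuesAbove E γ {j ∈ insert k s | j < i} i).encard =
        ∑ i ∈ s, (Set.Ico (a i) (γ i) ∩ valuesAbove E γ {j ∈ s | j < i} i).encard :=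
      Finset.sum_congr rfl fun i hi => by
        rw [Finset.filter_insert, if_neg (hk i hi).not_gt]
    rw [Finset.piecewise_insert, length_update hL _ _ (by rw [hpk]; exact haγ k), ih, hpk, hvalues,
      Finset.sum_insert hks, hfilter, hsum, add_assoc, add_comm (∑ _ ∈ s, _)]

end LengthPath

section PairMaximals

namespace IsGoodSet

variable {κ : Type*} {A : Set (κ → ℤ)} {α γ : κ → ℤ} {i j : κ}

theorem mem_maximals_iff (hA : IsGoodSet A) (hij : i ≠ j) (h : ∀ k, k = i ∨ k = j) :
    α ∈ maximals A ↔ α ∈ A ∧ ∀ β ∈ A, β j = α j → β i ≤ α i := by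
  refine and_congr_right fun hα => ⟨fun hempty β hβ hj => ?_, fun hle k => ?_⟩
  · by_contra! hi
    refine Set.notMem_empty β (hempty j ▸ ⟨hβ, by simpa, fun k hk => ?_⟩)
    rwa [(h k).resolve_right (by simpa using hk)]
  · refine Set.eq_empty_iff_forall_notMem.2 fun β ⟨hβ, heq, hlt⟩ => ?_
    rcases h k with rfl | rfl
    · obtain ⟨ε, hε, hεk, hε'⟩ := hA.exchange α hα β hβ k (heq k (by simp)).symm
      have hαβ : α j < β j := hlt j (by simpa using hij.symm)
      exact hεk.not_ge (hle ε hε (by rw [(hε' j).2 hαβ.ne, min_eq_left hαβ.le]))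
    · exact (hlt i (by simpa using hij)).not_ge (hle β hβ (heq k (by simp)))

theorem injOn_eval_maximals (hA : IsGoodSet A) (hij : i ≠ j) (h : ∀ k, k = i ∨ k = j) :
    Set.InjOn (Function.eval j) (maximals A) := by
  intro α hα β hβ hj
  rw [hA.mem_maximals_iff hij h] at hα hβ
  have hi : α i = β i := le_antisymm (hβ.2 α hα.1 hj) (hα.2 β hβ.1 hj.symm)
  exact funext fun k => (h k).elim (fun hk => hk ▸ hi) fun hk => hk ▸ hj

theorem image_eval_maximals (hA : IsGoodSet A) (hij : i ≠ j) (h : ∀ k, k = i ∨ k = j)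
    (hγ : Set.Ici γ ⊆ A) :
    Function.eval j '' maximals A = Function.eval j '' A \ valuesAbove A γ {i} j := by
  classical
  ext n
  constructor
  · rintro ⟨α, hα, rfl⟩
    rw [hA.mem_maximals_iff hij h] at hα
    refine ⟨⟨α, hα.1, rfl⟩, fun ⟨β, hβ, hj, hi⟩ => ?_⟩
    have hmem := hA.update_mem hγ hβ (hi i (by simp)) (le_max_left (γ i) (α i + 1))
    have hle := hα.2 _ hmem (by rwa [Function.update_of_ne hij.symm])
    rw [Function.update_self] at hle
    omega
  · rintro ⟨⟨β, hβ, rfl⟩, hn⟩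
    have hbdd : BddAbove {x | ∃ α ∈ A, α j = β j ∧ α i = x} := by
      refine ⟨γ i, ?_⟩
      rintro _ ⟨α, hα, hj, rfl⟩
      by_contra! hi
      exact hn ⟨α, hα, hj, by simpa using hi.le⟩
    obtain ⟨m, ⟨α, hα, hj, rfl⟩, hm⟩ := hbdd.exists_isGreatest_of_nonempty ⟨_, β, hβ, rfl, rfl⟩
    exact ⟨α, (hA.mem_maximals_iff hij h).2 ⟨hα, fun δ hδ hδj => hm ⟨δ, hδ, hδj.trans hj, rfl⟩⟩, hj⟩

end IsGoodSet

variable {ι : Type*} {E : Set (ι → ℤ)} {γ : ι → ℤ} {i j : ι}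

theorem finite_image_eval_sdiff_valuesAbove {J : Finset ι} {k : ι} (hE : IsGoodSet E)
    (hγ : Set.Ici γ ⊆ E) : (Function.eval k '' E \ valuesAbove E γ J k).Finite :=
  have ⟨_, hl⟩ := hE.bddBelow
  (Set.finite_Ico _ _).subset (image_eval_sdiff_valuesAbove_subset_Ico hl hγ)

theorem image_eval_image_restrict {s : Finset ι} (k : s) :
    Function.eval k '' (s.restrict '' E) = Function.eval (k : ι) '' E :=
  Set.image_image ..

theorem valuesAbove_image_restrict {s : Finset ι} (i k : s) :
    valuesAbove (s.restrict '' E) (s.restrict γ) {i} k = valuesAbove E γ {(i : ι)} k := by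
  ext n
  simp [valuesAbove]

namespace IsGoodSet

variable [DecidableEq ι]

theorem bijOn_maximals_image_restrict (hE : IsGoodSet E) (hγ : Set.Ici γ ⊆ E) (hij : i ≠ j) :
    Set.BijOn (fun β : ({i, j} : Finset ι) → ℤ => β ⟨j, by simp⟩)
      (maximals (({i, j} : Finset ι).restrict '' E))
      (Function.eval j '' E \ valuesAbove E γ {i} j) := by
  have hA := hE.restrict {i, j}
  have hi : i ∈ ({i, j} : Finset ι) := Finset.mem_insert_self i {j}
  have hj : j ∈ ({i, j} : Finset ι) := Finset.mem_insert_of_mem (Finset.mem_singleton_self j)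
  have hne : (⟨i, hi⟩ : ({i, j} : Finset ι)) ≠ ⟨j, hj⟩ := Subtype.coe_ne_coe.1 hij
  have hcover : ∀ k : ({i, j} : Finset ι), k = ⟨i, hi⟩ ∨ k = ⟨j, hj⟩ := by
    simp [Subtype.ext_iff]
  have himage := hA.image_eval_maximals hne hcover (Ici_restrict_subset_image_restrict _ hγ)
  rw [image_eval_image_restrict, valuesAbove_image_restrict] at himage
  exact himage ▸ (hA.injOn_eval_maximals hne hcover).bijOn_image

theorem finite_maximals_image_restrict (hE : IsGoodSet E) (hij : i ≠ j) :
    (maximals (({i, j} : Finset ι).restrict '' E)).Finite := by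
  obtain ⟨γ, hγ⟩ := hE.exists_Ici_subset
  exact (hE.bijOn_maximals_image_restrict hγ hij).finite_iff_finite.2
    (finite_image_eval_sdiff_valuesAbove hE hγ)

theorem ncard_maximals_image_restrict (hE : IsGoodSet E) (hγ : Set.Ici γ ⊆ E) (hij : i ≠ j) :
    (maximals (({i, j} : Finset ι).restrict '' E)).ncard =
      (Function.eval j '' E \ valuesAbove E γ {i} j).ncard := by
  have hbij := hE.bijOn_maximals_image_restrict hγ hij
  rw [← hbij.image_eq, hbij.injOn.ncard_image]

end IsGoodSet

end PairMaximals

section Staircases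

/-- A planar set shaped like a slice of a good set: closed under infima, bounded below, and
containing with each of its points the half-lines to the right of `x = a` and above `y = b`. -/
structure IsStaircase (Q : Set (ℤ × ℤ)) (a b : ℤ) : Prop where
  infClosed : InfClosed Q
  bddBelow : BddBelow Q
  right_mem : ∀ {x x' y : ℤ}, (x, y) ∈ Q → a ≤ x → a ≤ x' → (x', y) ∈ Q
  up_mem : ∀ {x y y' : ℤ}, (x, y) ∈ Q → b ≤ y → b ≤ y' → (x, y') ∈ Q

/-- The abscissas at which the staircase bounding `Q` from above steps down: some point of `Q` is
higher there than every point of `Q` further to the right. -/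
def steps (Q : Set (ℤ × ℤ)) : Set ℤ :=
  {x | ∃ y, (x, y) ∈ Q ∧ ∀ w ∈ Q, x < w.1 → w.2 < y}

/-- The protruding corners of the staircase bounding `Q` from above. -/
def outerCorners (Q : Set (ℤ × ℤ)) : Set (ℤ × ℤ) :=
  {z | Maximal (· ∈ Q) z}

/-- The reentrant corners of the staircase bounding `Q` from above. -/
def innerCorners (Q : Set (ℤ × ℤ)) : Set (ℤ × ℤ) :=
  {z ∈ Q | (∀ w ∈ Q, z.1 < w.1 → w.2 ≤ z.2) ∧ (∃ y > z.2, (z.1, y) ∈ Q) ∧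
    ∃ x > z.1, (x, z.2) ∈ Q}

variable {Q : Set (ℤ × ℤ)} {a b : ℤ}

theorem injOn_fst_innerCorners : Set.InjOn Prod.fst (innerCorners Q) := by
  have hle {z w : ℤ × ℤ} (hz : z ∈ innerCorners Q) (hw : w ∈ innerCorners Q) (h : z.1 = w.1) :
      w.2 ≤ z.2 := by
    obtain ⟨-, -, -, x, hx, hxw⟩ := hw
    exact hz.2.1 (x, w.2) hxw (h.trans_lt hx)
  exact fun z hz w hw h => Prod.ext h (le_antisymm (hle hw hz h.symm) (hle hz hw h))

theorem injOn_fst_outerCorners : Set.InjOn Prod.fst (outerCorners Q) := by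
  intro z hz w hw h
  rcases le_total z.2 w.2 with hzw | hwz
  · exact hz.eq_of_le hw.prop ⟨h.le, hzw⟩
  · exact hw.eq_of_ge hz.prop ⟨h.ge, hwz⟩

namespace IsStaircase

theorem image_fst_innerCorners (hQ : IsStaircase Q a b) :
    Prod.fst '' innerCorners Q = steps Q ∩ {x | ∃ z ∈ Q, x < z.1} := by
  ext x
  constructor
  · rintro ⟨z, ⟨-, hle, ⟨y, hy, hyQ⟩, x, hx, hxQ⟩, rfl⟩
    exact ⟨⟨y, hyQ, fun w hw hzw => (hle w hw hzw).trans_lt hy⟩, _, hxQ, hx⟩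
  · rintro ⟨⟨y, hy, hlt⟩, z, hz, hxz⟩
    have hbdd : BddAbove (Prod.snd '' {w ∈ Q | x < w.1}) :=
      ⟨y, Set.forall_mem_image.2 fun w hw => (hlt w hw.1 hw.2).le⟩
    obtain ⟨-, ⟨w, ⟨hw, hxw⟩, rfl⟩, hmax⟩ :=
      hbdd.exists_isGreatest_of_nonempty ⟨_, z, ⟨hz, hxz⟩, rfl⟩
    have hxw₂ : (x, w.2) ∈ Q := by
      have hinf := hQ.infClosed hy hw
      rwa [← Prod.mk.eta (p := w), Prod.mk_inf_mk, inf_eq_left.2 hxw.le,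
        inf_eq_right.2 (hlt w hw hxw).le] at hinf
    exact ⟨(x, w.2), ⟨hxw₂, fun v hv hxv => hmax ⟨v, ⟨hv, hxv⟩, rfl⟩, ⟨y, hlt w hw hxw, hy⟩,
      w.1, hxw, hw⟩, rfl⟩

theorem image_fst_outerCorners (hQ : IsStaircase Q a b) :
    Prod.fst '' outerCorners Q = steps Q \ {x | ∃ y, (x, y) ∈ Q ∧ b ≤ y} := by
  ext x
  constructor
  · rintro ⟨z, hz, rfl⟩
    refine ⟨⟨z.2, hz.prop, fun w hw hzw => ?_⟩, fun ⟨y, hy, hby⟩ => ?_⟩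
    · by_contra! hle
      exact hzw.not_ge (hz.le_of_ge hw ⟨hzw.le, hle⟩).1
    · have hup := hQ.up_mem hy hby (le_max_left b (z.2 + 1))
      have hle := (hz.le_of_ge hup ⟨le_rfl, by simp only; omega⟩).2
      simp only at hle
      omega
  · rintro ⟨⟨y, hy, hlt⟩, hb⟩
    have hbdd : BddAbove {y | (x, y) ∈ Q} := ⟨b, fun y hy => not_lt.1 fun h => hb ⟨y, hy, h.le⟩⟩
    obtain ⟨m, hm, hmax⟩ := hbdd.exists_isGreatest_of_nonempty ⟨y, hy⟩
    refine ⟨(x, m), ⟨hm, fun ⟨x', y'⟩ hw ⟨hx, hmy⟩ => ?_⟩, rfl⟩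
    rcases hx.eq_or_lt with rfl | hx
    · exact ⟨le_rfl, hmax hw⟩
    · exact absurd (hlt _ hw hx) (((hmax hy).trans hmy).not_gt)

theorem lt_of_mem_steps (hQ : IsStaircase Q a b) {x : ℤ} (hx : x ∈ steps Q) : x < a := by
  obtain ⟨y, hy, hlt⟩ := hx
  by_contra! hax
  exact lt_irrefl y (hlt _ (hQ.right_mem hy hax (hax.trans (lt_add_one x).le)) (lt_add_one x))

theorem finite_steps (hQ : IsStaircase Q a b) : (steps Q).Finite := by
  obtain ⟨l, hl⟩ := hQ.bddBelow
  exact (Set.finite_Ico l.1 a).subset fun x hx =>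
    ⟨(hl hx.choose_spec.1).1, hQ.lt_of_mem_steps hx⟩

theorem finite_innerCorners (hQ : IsStaircase Q a b) : (innerCorners Q).Finite :=
  .of_finite_image (hQ.image_fst_innerCorners ▸ hQ.finite_steps.inter_of_left _)
    injOn_fst_innerCorners

theorem finite_outerCorners (hQ : IsStaircase Q a b) : (outerCorners Q).Finite :=
  .of_finite_image (hQ.image_fst_outerCorners ▸ hQ.finite_steps.sdiff) injOn_fst_outerCorners

open Classical in
theorem ncard_innerCorners_add (hQ : IsStaircase Q a b) (hne : Q.Nonempty) :
    (innerCorners Q).ncard + (if ∃ z ∈ Q, a ≤ z.1 then 0 else 1) = (steps Q).ncard := by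
  rw [← injOn_fst_innerCorners.ncard_image, hQ.image_fst_innerCorners,
    ← Set.ncard_inter_add_ncard_sdiff_eq_ncard (steps Q) {x | ∃ z ∈ Q, x < z.1} hQ.finite_steps]
  congr 1
  split_ifs with ha
  · obtain ⟨z, hz, haz⟩ := ha
    have hsub : steps Q ⊆ {x | ∃ z ∈ Q, x < z.1} :=
      fun x hx => ⟨z, hz, (hQ.lt_of_mem_steps hx).trans_le haz⟩
    rw [Set.sdiff_eq_empty.2 hsub, Set.ncard_empty]
  · have hbdd : BddAbove (Prod.fst '' Q) :=
      ⟨a, Set.forall_mem_image.2 fun z hz => not_lt.1 fun h => ha ⟨z, hz, h.le⟩⟩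
    obtain ⟨-, ⟨z, hz, rfl⟩, hmax⟩ := hbdd.exists_isGreatest_of_nonempty (hne.image _)
    have hle {w : ℤ × ℤ} (hw : w ∈ Q) : w.1 ≤ z.1 := hmax ⟨w, hw, rfl⟩
    have hstep : z.1 ∈ steps Q := ⟨z.2, hz, fun w hw hzw => absurd hzw (hle hw).not_gt⟩
    rw [eq_comm, Set.ncard_eq_one]
    refine ⟨z.1, Set.eq_singleton_iff_unique_mem.2 ⟨⟨hstep, ?_⟩, ?_⟩⟩
    · exact fun ⟨w, hw, hzw⟩ => hzw.not_ge (hle hw)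
    · rintro x ⟨⟨y, hy, -⟩, hx⟩
      exact le_antisymm (hle hy) (not_lt.1 fun h => hx ⟨z, hz, h⟩)

open Classical in
theorem ncard_outerCorners_add (hQ : IsStaircase Q a b) (hab : ¬ ∃ z ∈ Q, a ≤ z.1 ∧ b ≤ z.2) :
    (outerCorners Q).ncard + (if ∃ z ∈ Q, b ≤ z.2 then 1 else 0) = (steps Q).ncard := by
  rw [← injOn_fst_outerCorners.ncard_image, hQ.image_fst_outerCorners,
    ← Set.ncard_inter_add_ncard_sdiff_eq_ncard (steps Q) {x | ∃ y, (x, y) ∈ Q ∧ b ≤ y}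
    hQ.finite_steps, add_comm]
  congr 1
  split_ifs with hb
  · have hbdd : BddAbove (Prod.fst '' {z ∈ Q | b ≤ z.2}) :=
      ⟨a, Set.forall_mem_image.2 fun z hz => not_lt.1 fun h => hab ⟨z, hz.1, h.le, hz.2⟩⟩
    obtain ⟨-, ⟨z, ⟨hz, hbz⟩, rfl⟩, hmax⟩ :=
      hbdd.exists_isGreatest_of_nonempty (Set.Nonempty.image _ hb)
    have hle {w : ℤ × ℤ} (hw : w ∈ Q) (hbw : b ≤ w.2) : w.1 ≤ z.1 := hmax ⟨w, ⟨hw, hbw⟩, rfl⟩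
    have hstep : z.1 ∈ steps Q :=
      ⟨z.2, hz, fun w hw hzw => not_le.1 fun h => hzw.not_ge (hle hw (hbz.trans h))⟩
    rw [eq_comm, Set.ncard_eq_one]
    refine ⟨z.1, Set.eq_singleton_iff_unique_mem.2 ⟨⟨hstep, z.2, hz, hbz⟩, ?_⟩⟩
    · rintro x ⟨⟨y, -, hlt⟩, y', hy', hby'⟩
      refine le_antisymm (hle hy' hby') (not_lt.1 fun h => ?_)
      have hup := hlt _ (hQ.up_mem hz hbz (le_max_left b y)) h
      exact hup.not_ge (le_max_right b y)
  · rw [Set.disjoint_iff_inter_eq_empty.1, Set.ncard_empty]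
    exact Set.disjoint_left.2 fun x _ ⟨y, hy, hby⟩ => hb ⟨_, hy, hby⟩

theorem exists_gt_mem (hQ : IsStaircase Q a b) (hab : ∃ z ∈ Q, a ≤ z.1 ∧ b ≤ z.2) (z : ℤ × ℤ) :
    ∃ w ∈ Q, z.1 < w.1 ∧ z.2 < w.2 := by
  obtain ⟨v, hv, hav, hbv⟩ := hab
  exact ⟨_, hQ.up_mem (hQ.right_mem hv hav (le_max_left a (z.1 + 1))) hbv
    (le_max_left b (z.2 + 1)), by simp only; omega, by simp only; omega⟩

theorem innerCorners_eq_empty (hQ : IsStaircase Q a b)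
    (hab : Q.Nonempty → ∃ z ∈ Q, a ≤ z.1 ∧ b ≤ z.2) : innerCorners Q = ∅ := by
  refine Set.eq_empty_iff_forall_notMem.2 fun z hz => ?_
  obtain ⟨w, hw, h₁, h₂⟩ := hQ.exists_gt_mem (hab ⟨z, hz.1⟩) z
  exact h₂.not_ge (hz.2.1 w hw h₁)

theorem outerCorners_eq_empty (hQ : IsStaircase Q a b)
    (hab : Q.Nonempty → ∃ z ∈ Q, a ≤ z.1 ∧ b ≤ z.2) : outerCorners Q = ∅ := by
  refine Set.eq_empty_iff_forall_notMem.2 fun z hz => ?_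
  obtain ⟨w, hw, h₁, h₂⟩ := hQ.exists_gt_mem (hab ⟨z, hz.prop⟩) z
  exact h₂.not_ge (hz.le_of_ge hw ⟨h₁.le, h₂.le⟩).2

end IsStaircase

end Staircases

section Slices

/-- The slice `x₂ = n` of a set of points of `ℤ³`, as a planar set. -/
def slice (X : Set (Fin 3 → ℤ)) (n : ℤ) : Set (ℤ × ℤ) :=
  {z | ![z.1, z.2, n] ∈ X}

variable {X E : Set (Fin 3 → ℤ)} {γ : Fin 3 → ℤ} {n : ℤ} {S : Finset ℤ}

theorem mem_slice_of_mem {α : Fin 3 → ℤ} (hα : α ∈ X) (hn : α 2 = n) :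
    (α 0, α 1) ∈ slice X n := by
  subst hn
  rwa [slice, Set.mem_ofPred_eq, show ![α 0, α 1, α 2] = α from FinVec.etaExpand_eq α]

theorem exists_mem_slice_iff {P : ℤ → ℤ → Prop} :
    (∃ z ∈ slice X n, P z.1 z.2) ↔ ∃ α ∈ X, α 2 = n ∧ P (α 0) (α 1) := by
  constructor
  · rintro ⟨z, hz, hP⟩
    exact ⟨_, hz, rfl, hP⟩
  · rintro ⟨α, hα, hn, hP⟩
    exact ⟨_, mem_slice_of_mem hα hn, hP⟩

theorem bijOn_slice (X : Set (Fin 3 → ℤ)) (n : ℤ) :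
    Set.BijOn (fun z : ℤ × ℤ => ![z.1, z.2, n]) (slice X n) (X ∩ Function.eval 2 ⁻¹' {n}) := by
  refine ⟨fun z hz => ⟨hz, rfl⟩, fun z _ w _ h => Prod.ext (congrFun h 0) (congrFun h 1), ?_⟩
  rintro α ⟨hα, rfl⟩
  exact ⟨_, mem_slice_of_mem hα rfl, FinVec.etaExpand_eq α⟩

theorem mapsTo_eval_of_slice_eq_empty (hS : ∀ n ∉ S, slice X n = ∅) :
    Set.MapsTo (Function.eval 2) X S := by
  intro α hα
  by_contra hn
  have hempty := (bijOn_slice X (α 2)).image_eq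
  rw [hS _ hn, Set.image_empty] at hempty
  exact Set.notMem_empty α (hempty ▸ ⟨hα, rfl⟩)

theorem finite_of_finite_slice (hS : ∀ n ∉ S, slice X n = ∅) (hfin : ∀ n, (slice X n).Finite) :
    X.Finite :=
  .of_finite_fibers (Function.eval 2)
    (S.finite_toSet.subset (mapsTo_eval_of_slice_eq_empty hS).image_subset)
    fun n _ => (bijOn_slice X n).finite_iff_finite.1 (hfin n)

theorem ncard_eq_sum_ncard_slice (hX : X.Finite) (hS : ∀ n ∉ S, slice X n = ∅) :
    X.ncard = ∑ n ∈ S, (slice X n).ncard := by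
  lift X to Finset (Fin 3 → ℤ) using hX
  rw [Set.ncard_coe_finset, Finset.card_eq_sum_card_fiberwise (mapsTo_eval_of_slice_eq_empty hS)]
  refine Finset.sum_congr rfl fun n _ => ?_
  rw [← (bijOn_slice _ n).injOn.ncard_image, (bijOn_slice _ n).image_eq, ← Set.ncard_coe_finset]
  congr 1
  ext α
  simp

theorem fiber_nonempty_iff {J : Finset (Fin 3)} (hJ : 2 ∈ J) {z : ℤ × ℤ} :
    (fiber J E ![z.1, z.2, n]).Nonempty ↔ ∃ w ∈ slice E n,
      (if 0 ∈ J then w.1 = z.1 else z.1 < w.1) ∧ (if 1 ∈ J then w.2 = z.2 else z.2 < w.2) := by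
  rw [exists_mem_slice_iff (P := fun x y =>
    (if 0 ∈ J then x = z.1 else z.1 < x) ∧ (if 1 ∈ J then y = z.2 else z.2 < y))]
  refine exists_congr fun α => and_congr_right fun _ => ?_
  simp only [Fin.forall_fin_succ, Matrix.cons_val_zero]
  split_ifs <;> simp_all <;> tauto

namespace IsGoodSet

theorem slice_absoluteMaximals (hE : IsGoodSet E) (n : ℤ) :
    slice (absoluteMaximals E) n = outerCorners (slice E n) := by
  ext z
  rw [slice, Set.mem_ofPred_eq, hE.mem_absoluteMaximals_iff 2]
  refine ⟨fun h => ⟨h.prop.1, fun w hw hzw => ?_⟩, fun h => ⟨⟨h.prop, rfl⟩, ?_⟩⟩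
  · have hle := h.le_of_ge ⟨hw, rfl⟩
      (by simpa [Pi.le_def, Fin.forall_fin_succ] using Prod.le_def.1 hzw)
    exact ⟨hle 0, hle 1⟩
  · rintro β ⟨hβ, hβn⟩ hle
    have hz := h.le_of_ge (mem_slice_of_mem hβ hβn) ⟨hle 0, hle 1⟩
    simpa [Pi.le_def, Fin.forall_fin_succ, hβn] using Prod.le_def.1 hz

theorem slice_relativeMaximals (hE : IsGoodSet E) (n : ℤ) :
    slice (relativeMaximals E) n = innerCorners (slice E n) := by
  ext z
  rw [slice, Set.mem_ofPred_eq, hE.mem_relativeMaximals_iff 2, ← Set.not_nonempty_iff_eq_empty,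
    fiber_nonempty_iff (by decide)]
  refine and_congr_right fun _ => and_congr ?_ ?_
  · simp
  · simp [Fin.forall_fin_succ, fiber_nonempty_iff, and_comm]

theorem isStaircase_slice (hE : IsGoodSet E) (hγ : Set.Ici γ ⊆ E) (n : ℤ) :
    IsStaircase (slice E n) (γ 0) (γ 1) where
  infClosed z hz w hw := mem_slice_of_mem (hE.infClosed hz hw) (min_self n)
  bddBelow := by
    obtain ⟨l, hl⟩ := hE.bddBelow
    exact ⟨(l 0, l 1), fun z hz => ⟨hl hz 0, hl hz 1⟩⟩
  right_mem h hx hx' := mem_slice_of_mem (hE.update_mem hγ h (i := 0) hx hx') rfl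
  up_mem h hy hy' := mem_slice_of_mem (hE.update_mem hγ h (i := 1) hy hy') rfl

end IsGoodSet

end Slices

section Triples

variable {E : Set (Fin 3 → ℤ)} {γ : Fin 3 → ℤ} {n : ℤ}

theorem mem_valuesAbove_iff_exists_mem_slice {J : Finset (Fin 3)} (hJ : 2 ∉ J) :
    n ∈ valuesAbove E γ J 2 ↔
      ∃ z ∈ slice E n, (0 ∈ J → γ 0 ≤ z.1) ∧ (1 ∈ J → γ 1 ≤ z.2) := by
  rw [exists_mem_slice_iff (P := fun x y => (0 ∈ J → γ 0 ≤ x) ∧ (1 ∈ J → γ 1 ≤ y))]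
  simp [valuesAbove, Fin.forall_fin_succ, hJ]

theorem exists_mem_slice_of_notMem (hn : n ∉ Function.eval 2 '' E \ valuesAbove E γ {0, 1} 2)
    (hne : (slice E n).Nonempty) : ∃ z ∈ slice E n, γ 0 ≤ z.1 ∧ γ 1 ≤ z.2 := by
  obtain ⟨z, hz⟩ := hne
  have hn' : n ∈ valuesAbove E γ {0, 1} 2 := by_contra fun h => hn ⟨⟨_, hz, rfl⟩, h⟩
  simpa [mem_valuesAbove_iff_exists_mem_slice] using hn'

theorem ncard_eq_sum_ite_mem {α : Type*} {D : Set α} [DecidablePred (· ∈ D)] {S : Finset α}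
    (hD : D ⊆ S) : D.ncard = ∑ n ∈ S, if n ∈ D then 1 else 0 := by
  rw [← Finset.card_filter, ← Set.ncard_coe_finset, Finset.coe_filter]
  congr 1
  exact Set.ext fun x => ⟨fun hx => ⟨hD hx, hx⟩, fun hx => hx.2⟩

namespace IsGoodSet

theorem slice_relativeMaximals_eq_empty (hE : IsGoodSet E) (hγ : Set.Ici γ ⊆ E)
    (hn : n ∉ Function.eval 2 '' E \ valuesAbove E γ {0, 1} 2) :
    slice (relativeMaximals E) n = ∅ :=
  (hE.slice_relativeMaximals n).trans <|
    (hE.isStaircase_slice hγ n).innerCorners_eq_empty (exists_mem_slice_of_notMem hn)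

theorem slice_absoluteMaximals_eq_empty (hE : IsGoodSet E) (hγ : Set.Ici γ ⊆ E)
    (hn : n ∉ Function.eval 2 '' E \ valuesAbove E γ {0, 1} 2) :
    slice (absoluteMaximals E) n = ∅ :=
  (hE.slice_absoluteMaximals n).trans <|
    (hE.isStaircase_slice hγ n).outerCorners_eq_empty (exists_mem_slice_of_notMem hn)

theorem finite_relativeMaximals (hE : IsGoodSet E) : (relativeMaximals E).Finite := by
  obtain ⟨γ, hγ⟩ := hE.exists_Ici_subset
  have hS := finite_image_eval_sdiff_valuesAbove (k := 2) (J := {0, 1}) hE hγ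
  refine finite_of_finite_slice (S := hS.toFinset)
    (fun n hn => hE.slice_relativeMaximals_eq_empty hγ (by rwa [hS.mem_toFinset] at hn)) fun n => ?_
  rw [hE.slice_relativeMaximals]
  exact (hE.isStaircase_slice hγ n).finite_innerCorners

theorem finite_absoluteMaximals (hE : IsGoodSet E) : (absoluteMaximals E).Finite := by
  obtain ⟨γ, hγ⟩ := hE.exists_Ici_subset
  have hS := finite_image_eval_sdiff_valuesAbove (k := 2) (J := {0, 1}) hE hγ
  refine finite_of_finite_slice (S := hS.toFinset)
    (fun n hn => hE.slice_absoluteMaximals_eq_empty hγ (by rwa [hS.mem_toFinset] at hn)) fun n => ?_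
  rw [hE.slice_absoluteMaximals]
  exact (hE.isStaircase_slice hγ n).finite_outerCorners

open Classical in
theorem ncard_slice_relativeMaximals_add (hE : IsGoodSet E) (hγ : Set.Ici γ ⊆ E)
    (hn : n ∈ Function.eval 2 '' E \ valuesAbove E γ {0, 1} 2) :
    (slice (relativeMaximals E) n).ncard +
        (if n ∈ Function.eval 2 '' E \ valuesAbove E γ {0} 2 then 1 else 0) +
        (if n ∈ Function.eval 2 '' E \ valuesAbove E γ {1} 2 then 1 else 0) =
      (slice (absoluteMaximals E) n).ncard + 1 := by
  have hQ := hE.isStaircase_slice hγ n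
  obtain ⟨himage, hn⟩ := hn
  have hne : (slice E n).Nonempty :=
    have ⟨_, hα, hαn⟩ := himage
    ⟨_, mem_slice_of_mem hα hαn⟩
  have hinner := hQ.ncard_innerCorners_add hne
  have houter := hQ.ncard_outerCorners_add
    (by simpa [mem_valuesAbove_iff_exists_mem_slice] using hn)
  have h₀ : n ∈ Function.eval 2 '' E \ valuesAbove E γ {0} 2 ↔
      ¬ ∃ z ∈ slice E n, γ 0 ≤ z.1 := by
    rw [Set.mem_sdiff, and_iff_right himage, mem_valuesAbove_iff_exists_mem_slice (by decide)]
    simp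
  have h₁ : n ∈ Function.eval 2 '' E \ valuesAbove E γ {1} 2 ↔
      ¬ ∃ z ∈ slice E n, γ 1 ≤ z.2 := by
    rw [Set.mem_sdiff, and_iff_right himage, mem_valuesAbove_iff_exists_mem_slice (by decide)]
    simp
  rw [hE.slice_relativeMaximals, hE.slice_absoluteMaximals]
  simp only [h₀, h₁, ite_not]
  split_ifs at hinner houter ⊢ <;> omega

open Classical in
theorem ncard_relativeMaximals_add (hE : IsGoodSet E) (hγ : Set.Ici γ ⊆ E) :
    (relativeMaximals E).ncard + (Function.eval 2 '' E \ valuesAbove E γ {0} 2).ncard +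
        (Function.eval 2 '' E \ valuesAbove E γ {1} 2).ncard =
      (absoluteMaximals E).ncard + (Function.eval 2 '' E \ valuesAbove E γ {0, 1} 2).ncard := by
  have hfin := finite_image_eval_sdiff_valuesAbove (k := 2) (J := {0, 1}) hE hγ
  have hsub (i : Fin 3) (hi : i ∈ ({0, 1} : Finset (Fin 3))) :
      Function.eval 2 '' E \ valuesAbove E γ {i} 2 ⊆ hfin.toFinset := by
    rw [hfin.coe_toFinset]
    refine Set.sdiff_subset_sdiff_right fun n ⟨β, hβ, hn, hle⟩ => ⟨β, hβ, hn, fun j hj => ?_⟩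
    exact hle j (by simp_all)
  rw [ncard_eq_sum_ncard_slice hE.finite_relativeMaximals (S := hfin.toFinset) fun n hn =>
      hE.slice_relativeMaximals_eq_empty hγ (by rwa [hfin.mem_toFinset] at hn),
    ncard_eq_sum_ncard_slice hE.finite_absoluteMaximals (S := hfin.toFinset) fun n hn =>
      hE.slice_absoluteMaximals_eq_empty hγ (by rwa [hfin.mem_toFinset] at hn),
    ncard_eq_sum_ite_mem (hsub 0 (by decide)), ncard_eq_sum_ite_mem (hsub 1 (by decide)),
    Set.ncard_eq_toFinset_card _ hfin, Finset.card_eq_sum_ones, ← Finset.sum_add_distrib,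
    ← Finset.sum_add_distrib, ← Finset.sum_add_distrib]
  exact Finset.sum_congr rfl fun n hn =>
    hE.ncard_slice_relativeMaximals_add hγ (hfin.mem_toFinset.1 hn)

theorem sum_ncard_maximals_image_restrict (hE : IsGoodSet E) (hγ : Set.Ici γ ⊆ E) :
    ∑ i : Fin 3, ∑ j ∈ Finset.Ioi i,
      ((maximals (({i, j} : Finset (Fin 3)).restrict '' E)).ncard : ℤ) =
        (Function.eval 1 '' E \ valuesAbove E γ {0} 1).ncard +
        (Function.eval 2 '' E \ valuesAbove E γ {0} 2).ncard +
        (Function.eval 2 '' E \ valuesAbove E γ {1} 2).ncard := by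
  rw [Fin.sum_univ_three, show Finset.Ioi (0 : Fin 3) = {1, 2} by decide,
    show Finset.Ioi (1 : Fin 3) = {2} by decide, show Finset.Ioi (2 : Fin 3) = ∅ by decide,
    Finset.sum_pair (by decide), Finset.sum_singleton, Finset.sum_empty, add_zero,
    hE.ncard_maximals_image_restrict hγ (show (0 : Fin 3) ≠ 1 by decide),
    hE.ncard_maximals_image_restrict hγ (show (0 : Fin 3) ≠ 2 by decide),
    hE.ncard_maximals_image_restrict hγ (show (1 : Fin 3) ≠ 2 by decide)]

theorem length_eq (hE : IsGoodSet E) {a : Fin 3 → ℤ} (ha : IsLeast E a)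
    (hγ : Set.Ici γ ⊆ E) {L : (Fin 3 → ℤ) → ℕ∞} (hLa : L a = 0)
    (hL : ∀ α i, L (Function.update α i (α i + 1)) =
      L α + ({α i} ∩ valuesAbove E α {i}ᶜ i).encard) :
    ∃ n : ℕ, L γ = n ∧ (n : ℤ) =
      ∑ i, (γ i - a i - ((gaps (Function.eval i '' E)).ncard : ℤ))
        - ∑ i, ∑ j ∈ Finset.Ioi i,
            ((maximals (({i, j} : Finset (Fin 3)).restrict '' E)).ncard : ℤ)
        - ((relativeMaximals E).ncard : ℤ) + ((absoluteMaximals E).ncard : ℤ) := by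
  have hlength := length_eq_add_sum hL ha.2 (ha.2 (hγ Set.self_mem_Ici))
  have hfin (k : Fin 3) : (Set.Ico (a k) (γ k) ∩ valuesAbove E γ {j | j < k} k).Finite :=
    (Set.finite_Ico _ _).inter_of_left _
  simp only [hLa, zero_add, ← (hfin _).cast_ncard_eq, ← Nat.cast_sum] at hlength
  refine ⟨_, hlength, ?_⟩
  push_cast
  simp only [ncard_Ico_inter_valuesAbove ha hγ, Finset.sum_sub_distrib _ (fun k =>
    ((Function.eval k '' E \ valuesAbove E γ {j | j < k} k).ncard : ℤ))]
  have hmissing : ∑ k : Fin 3,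
      ((Function.eval k '' E \ valuesAbove E γ {j | j < k} k).ncard : ℤ) =
        (Function.eval 1 '' E \ valuesAbove E γ {0} 1).ncard +
        (Function.eval 2 '' E \ valuesAbove E γ {0, 1} 2).ncard := by
    rw [Fin.sum_univ_three, show ({j | j < 0} : Finset (Fin 3)) = ∅ by decide,
      show ({j | j < 1} : Finset (Fin 3)) = {0} by decide,
      show ({j | j < 2} : Finset (Fin 3)) = {0, 1} by decide,
      image_eval_sdiff_valuesAbove_empty, Set.ncard_empty, Nat.cast_zero, zero_add]
  have hcorners := hE.ncard_relativeMaximals_add hγ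
  rw [hE.sum_ncard_maximals_image_restrict hγ, hmissing]
  omega

end IsGoodSet

end Triples

section FractionalIdeals

variable {R ι : Type*} [CommRing R] {p : ι ≃ minimalPrimes R}
  {𝓘 : FractionalIdeal R⁰ (FractionRing R)}

theorem valueSet_eq_finiteValues [IsReduced R] : valueSet p 𝓘 =
    finiteValues (fun i h => branchVal (p i) (projBranch (p i) h))
      (𝓘 : Submodule R (FractionRing R)) :=
  Set.ext fun α => mem_valueSet_iff p 𝓘 α

namespace IsCompleteAdmissible

variable [IsLocalRing R]

theorem exists_superlevel_le (hR : IsCompleteAdmissible R) (p : ι ≃ minimalPrimes R)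
    (h𝓘 : ∃ d ∈ R⁰, algebraMap R (FractionRing R) d ∈ 𝓘) :
    ∃ δ, (hR.isValuationFamily p).superlevel δ ≤ 𝓘 := by
  obtain ⟨N, hN⟩ := hR.exists_forall_le_branchVal_imp_mem h𝓘
  exact ⟨fun _ => N, fun h hh => hN h (p.forall_congr_right.1 hh)⟩

theorem exists_le_superlevel (hR : IsCompleteAdmissible R) (p : ι ≃ minimalPrimes R)
    (𝓘 : FractionalIdeal R⁰ (FractionRing R)) :
    ∃ δ, 𝓘 ≤ (hR.isValuationFamily p).superlevel δ := by
  obtain ⟨B, hB⟩ := hR.exists_forall_mem_le_branchVal 𝓘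
  exact ⟨fun _ => B, fun h hh i => hB h hh (p i)⟩

theorem isGoodSet_valueSet (hR : IsCompleteAdmissible R)
    (h𝓘 : ∃ d ∈ R⁰, algebraMap R (FractionRing R) d ∈ 𝓘) : IsGoodSet (valueSet p 𝓘) := by
  have := hR.isReduced
  have := hR.finite_minimalPrimes
  have := Finite.of_equiv _ p.symm
  have hk : ENat.card ι ≤ ENat.card (IsLocalRing.ResidueField R) :=
    (ENat.card_congr p).trans_le hR.residueField_large
  rw [valueSet_eq_finiteValues]
  exact (hR.isValuationFamily p).isGoodSet_finiteValues hk (hR.exists_superlevel_le p h𝓘)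
    (hR.exists_le_superlevel p 𝓘)

theorem partialValueSet_eq_image_restrict (hR : IsCompleteAdmissible R)
    (h𝓘 : ∃ d ∈ R⁰, algebraMap R (FractionRing R) d ∈ 𝓘) (J : Finset ι) :
    partialValueSet p 𝓘 J = J.restrict '' valueSet p 𝓘 := by
  have := hR.isReduced
  ext β
  rw [mem_partialValueSet_iff, valueSet_eq_finiteValues]
  constructor
  · rintro ⟨h, hh, hβ⟩
    obtain ⟨α, hα, hα'⟩ :=
      (hR.isValuationFamily p).exists_mem_finiteValues (hR.exists_superlevel_le p h𝓘) hh 0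
    refine ⟨α, hα, funext fun j => ?_⟩
    rcases hα' j with h | ⟨h, -⟩
    · exact WithTop.coe_injective (h.symm.trans (hβ j))
    · exact absurd (h.symm.trans (hβ j)) WithTop.top_ne_coe
  · rintro ⟨α, ⟨h, hh, hα⟩, rfl⟩
    exact ⟨h, hh, fun j => hα j⟩

theorem singleValueSet_eq_image_eval (hR : IsCompleteAdmissible R)
    (h𝓘 : ∃ d ∈ R⁰, algebraMap R (FractionRing R) d ∈ 𝓘) (i : ι) :
    singleValueSet p 𝓘 i = Function.eval i '' valueSet p 𝓘 := by
  ext n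
  rw [singleValueSet, Set.mem_ofPred_eq, hR.partialValueSet_eq_image_restrict h𝓘]
  simp [funext_iff]

theorem truncation_submoduleOf (hR : IsCompleteAdmissible R) (γ : ι → ℤ) :
    (truncation p 𝓘 γ).submoduleOf 𝓘 =
      ((hR.isValuationFamily p).superlevel γ).submoduleOf 𝓘 :=
  Submodule.ext fun h => and_iff_right h.2

theorem length_quotient_truncation_eq_zero (hR : IsCompleteAdmissible R)
    (h𝓘 : ∃ d ∈ R⁰, algebraMap R (FractionRing R) d ∈ 𝓘) {a : ι → ℤ}
    (ha : a ∈ lowerBounds (valueSet p 𝓘)) :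
    Module.length R ((𝓘 : Submodule R (FractionRing R)) ⧸ (truncation p 𝓘 a).submoduleOf
      (𝓘 : Submodule R (FractionRing R))) = 0 := by
  have := hR.isReduced
  rw [valueSet_eq_finiteValues] at ha
  rw [Module.length_eq_zero_iff, Submodule.Quotient.subsingleton_iff, hR.truncation_submoduleOf,
    Submodule.submoduleOf_eq_top]
  exact (hR.isValuationFamily p).le_superlevel (hR.exists_superlevel_le p h𝓘) ha

theorem length_quotient_truncation_update [Fintype ι] [DecidableEq ι]
    (hR : IsCompleteAdmissible R)
    (h𝓘 : ∃ d ∈ R⁰, algebraMap R (FractionRing R) d ∈ 𝓘) (γ : ι → ℤ) (i : ι) :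
    Module.length R ((𝓘 : Submodule R (FractionRing R)) ⧸
      (truncation p 𝓘 (Function.update γ i (γ i + 1))).submoduleOf
        (𝓘 : Submodule R (FractionRing R))) =
      Module.length R ((𝓘 : Submodule R (FractionRing R)) ⧸
        (truncation p 𝓘 γ).submoduleOf (𝓘 : Submodule R (FractionRing R))) +
        ({γ i} ∩ valuesAbove (valueSet p 𝓘) γ {i}ᶜ i).encard := by
  have := hR.isReduced
  rw [valueSet_eq_finiteValues, hR.truncation_submoduleOf, hR.truncation_submoduleOf]
  exact (hR.isValuationFamily p).length_quotient_superlevel_update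
    (hR.exists_superlevel_le p h𝓘) γ i

end IsCompleteAdmissible

end FractionalIdeals

end AdmissibleRing

theorem theorem18 {R : Type*} [CommRing R] [IsLocalRing R]
    (hR : AdmissibleRing.IsCompleteAdmissible R)
    (p : Fin 3 ≃ minimalPrimes R)
    (𝓘 : FractionalIdeal (nonZeroDivisors R) (FractionRing R))
    (h𝓘 : ∃ d ∈ nonZeroDivisors R, algebraMap R (FractionRing R) d ∈ 𝓘)
    (E : Set (Fin 3 → ℤ)) (hE : E = AdmissibleRing.valueSet p 𝓘) :
    (∀ i, IsDiscreteValuationRing (AdmissibleRing.BranchNormalization (p i))) ∧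
    ∃ α₀ c : Fin 3 → ℤ, IsLeast E α₀ ∧ AdmissibleRing.IsConductor E c ∧
      (∀ i, (AdmissibleRing.gaps (AdmissibleRing.singleValueSet p 𝓘 i)).Finite) ∧
      (∀ i j, i < j →
        (AdmissibleRing.maximals (AdmissibleRing.partialValueSet p 𝓘 {i, j})).Finite) ∧
      (AdmissibleRing.relativeMaximals E).Finite ∧
      (AdmissibleRing.absoluteMaximals E).Finite ∧
      ∀ γ : Fin 3 → ℤ, c ≤ γ →
        ∃ n : ℕ,
          Module.length R ((𝓘 : Submodule R (FractionRing R)) ⧸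
            (AdmissibleRing.truncation p 𝓘 γ).submoduleOf
              (𝓘 : Submodule R (FractionRing R))) = n ∧
          (n : ℤ) =
            ∑ i, ((γ i - α₀ i)
              - ((AdmissibleRing.gaps (AdmissibleRing.singleValueSet p 𝓘 i)).ncard : ℤ))
            - ∑ i, ∑ j ∈ Finset.Ioi i,
                ((AdmissibleRing.maximals
                  (AdmissibleRing.partialValueSet p 𝓘 {i, j})).ncard : ℤ)
            - ((AdmissibleRing.relativeMaximals E).ncard : ℤ)
            + ((AdmissibleRing.absoluteMaximals E).ncard : ℤ) := by
  subst hE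
  have hgood := hR.isGoodSet_valueSet (p := p) h𝓘
  obtain ⟨a, ha⟩ := hgood.exists_isLeast
  obtain ⟨c, hc⟩ := hgood.exists_isConductor
  simp only [hR.singleValueSet_eq_image_eval h𝓘, hR.partialValueSet_eq_image_restrict h𝓘]
  refine ⟨fun i => hR.isDiscreteValuationRing_branchNormalization (p i), a, c, ha, hc,
    fun i => AdmissibleRing.finite_gaps_image_eval ha hc.1,
    fun i j hij => hgood.finite_maximals_image_restrict hij.ne,
    hgood.finite_relativeMaximals, hgood.finite_absoluteMaximals, fun γ hγ => ?_⟩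
  exact hgood.length_eq
    (L := fun γ => Module.length R (_ ⧸ (AdmissibleRing.truncation p 𝓘 γ).submoduleOf 𝓘))
    ha ((Set.Ici_subset_Ici.2 hγ).trans hc.1)
    (hR.length_quotient_truncation_eq_zero h𝓘 ha.2) (hR.length_quotient_truncation_update h𝓘)
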